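/- For $d\ge 0$ let $T_d\in\mathbb Z[x]$ be the monic polynomial of degree $d$ (for $d\ge 1$) with $T_d(z+z^{-1})=z^d+z^{-d}$, and let $T_\ell^n$ denote the $n$-fold iterate of $T_\ell$. Let $\ell\neq p$ be primes and let $t\in\mathbb Z$ be such that $T_\ell^n(x)-t$ is irreducible in $\mathbb Z[x]$ for every $n\ge 1$. Let $\bar t\in\mathbb F_p$ be the reduction of $t$, and let $\nu_\ell$ be the $\ell$-adic valuation. Let $\mu$ be the order of $p$ in $(\mathbb Z/\ell\mathbb Z)^\times/\{\pm1\}$, let $D_1$ and $D_2$ be the elements of $\{p^\mu-1,p^\mu+1\}$ with the larger and the smaller $\ell$-adic valuation, respectively, and put $v=\nu_\ell(D_1)$. The preperiod of $a\in\mathbb F_p$ is the least $r\ge 0$ with $T_\ell^{r+k}(a)=T_\ell^{r}(a)$ for some $k\ge 1$; $a$ is periodic if its preperiod is $0$. Let $\rho$ be the preperiod of $\bar t$ and let $v_p$ be the largest preperiod of an element of $\mathbb F_p$. Write $T_\ell^{\rho}(\bar t)=\alpha+\alpha^{-1}$ with $\alpha\in\overline{\mathbb F}_p^{\times}$; the cycle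 to which $\bar t$ is connected is said to correspond to a divisor of $D_i$ if the multiplicative order of $\alpha$ divides $D_i$. Let $n\ge 1$. Below, "factors" are the distinct monic irreducible factors of $T_\ell^n(x)-t$ in $\mathbb F_p[x]$; they have multiplicity $1$ unless stated otherwise, and each list is complete. A list indexed by $k\in\{1,\dots,n-v\}$ is empty if $n\le v$. **Case 1: $\ell$ odd.** 1. If $\rho>0$, there are $\ell^n$ factors of degree $1$ if $n\le v-\rho$, and $\ell^{v-\rho}$ factors of degree $\ell^{n-v+\rho}$ if $n>v-\rho$. In particular, if $\rho=v$, then $T_\ell^n(x)-t$ is irreducible modulo $p$. 2. If $\bar t\in\{-2,2\}$, there are: one factor of degree $1$ and multiplicity $1$; $\sum_{k=0}^{\min(n,v)-1}\frac{\ell-1}{2\mu}\ell^k$ additional factors of degree $\mu$ and multiplicity $2$; and $\frac{\ell-1}{2\mu}\ell^{v-1}$ additional factors of degree $\mu\ell^k$ and multiplicity $2$ for each $k\in\{1,\dots,n-v\}$. 3. If $\bar t\notin\{-2,2\}$ is periodic and its cycle corresponds to a divisor of $D_1$, there are: one factor of degree $1$; $\sum_{k=0}^{\min(n,v)-1}\frac{\ell-1}{\mu}\ell^k$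 additional factors of degree $\mu$; and $\frac{\ell-1}{\mu}\ell^{v-1}$ additional factors of degree $\mu\ell^k$ for each $k\in\{1,\dots,n-v\}$. 4. If $\bar t\notin\{-2,2\}$ is periodic and its cycle corresponds to a divisor of $D_2$, there are: one factor of degree $1$; $\sum_{k=0}^{\min(n,v)-1}\frac{\ell-1}{2\mu}\ell^k$ additional factors of degree $2\mu$; and $\frac{\ell-1}{2\mu}\ell^{v-1}$ additional factors of degree $2\mu\ell^k$ for each $k\in\{1,\dots,n-v\}$. **Case 2: $\ell=2$.** 1. If $\rho>0$, $\bar t\ne-2$, and $\bar t$ is connected to a cycle corresponding to a divisor of $D_1$, there are $2^n$ factors of degree $1$ if $n\le v-\rho$, and $2^{v-\rho}$ factors of degree $2^{n-v+\rho}$ if $n>v-\rho$. In particular, if $\rho=v$, then $T_2^n(x)-t$ is irreducible modulo $p$. 2. If $\rho>0$ and $\bar t$ is connected to a cycle other than the fixed point $2$ corresponding to a divisor of $D_2$, there are $2^{n-1}$ factors of degree $2$ if $n\le v-\rho$, and $2^{v-\rho}$ factors of degree $2^{n-v+\rho}$ if $n>v-\rho$. 3. If $\bar t=-2$, there are $2^{n-1}$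 factors of degree $1$ and multiplicity $2$ if $n\le v-\rho$, and $2^{v-\rho-1}$ factors of degree $2^{n-v+\rho}$ and multiplicity $2$ if $n>v-\rho$. 4. If $\bar t=2$, then $T_2^n(x)-t\equiv(x-2)(x+2)\prod_{j=1}^{n-1}\bigl(T_2^{j}(x)+2\bigr)\pmod p$. Here $T_2^j(x)+2$ has $2^{j-1}$ factors of degree $1$ and multiplicity $2$ if $j+1\le v$, and $2^{v-2}$ factors of degree $2^{j+1-v}$ and multiplicity $2$ if $j+1>v$; the factors of $T_2^n(x)-t$ are $x-2$, $x+2$ and those of the $T_2^j(x)+2$, $1\le j\le n-1$, all distinct and with these multiplicities. 5. If $\bar t\ne2$ is periodic and its cycle corresponds to a divisor of $D_1$, there are: one factor of degree $1$; $\sum_{k=0}^{\min(n,v)-1}2^k$ additional factors of degree $1$; and $2^{v-1}$ additional factors of degree $2^k$ for each $k\in\{1,\dots,n-v\}$. 6. If $\bar t\ne2$ is periodic and its cycle corresponds to a divisor of $D_2$, there are: two factors of degree $1$; $\sum_{k=0}^{\min(n,v)-2}2^k$ additional factors of degree $2$; and $2^{v-1}$ additional factors of degree $2^{k}$ for each $k\in\{1,\dots,n-v\}$.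 **In particular,** if $v_p>0$ and $\rho=v_p$, then $T_\ell^n(x)-t$ is irreducible modulo $p$; and if $\ell$ is odd, $\rho>0$ and $n\le v_p-\rho$, then $T_\ell^n(x)-t$ splits into linear factors over $\mathbb F_p$. -/

import Mathlib

open Polynomial

noncomputable section

/-- `T_ℓ` over a commutative ring `R`: the monic polynomial of degree `ℓ` with
`T_ℓ(z + z⁻¹) = z ^ ℓ + z ^ (-ℓ)`. (Mathlib's `Polynomial.Chebyshev.C`; the polynomial that Mathlib
calls `Polynomial.Chebyshev.T` is normalised differently.) -/
def chebT (R : Type*) [CommRing R] (ℓ : ℕ) : R[X] := Polynomial.Chebyshev.C R (ℓ : ℤ)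

/-- The `n`-fold iterate `T_ℓ ∘ ⋯ ∘ T_ℓ` as a polynomial; the `0`-th iterate is `X`. -/
def chebIter (R : Type*) [CommRing R] (ℓ n : ℕ) : R[X] := (chebT R ℓ).comp^[n] X

/-- The self-map of `𝔽_p` given by `T_ℓ`. -/
def chebMap (ℓ p : ℕ) : ZMod p → ZMod p := fun a => (chebT (ZMod p) ℓ).eval a

/-- The preperiod of `a` under `f`: the least `r` such that `f^[r + k] a = f^[r] a` for some
`k ≥ 1`. -/
def preperiod {S : Type*} (f : S → S) (a : S) : ℕ :=
  sInf {r : ℕ | ∃ k : ℕ, 1 ≤ k ∧ f^[r + k] a = f^[r] a}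

/-- The largest preperiod of an element of `𝔽_p` under `T_ℓ`. -/
def maxPreperiod (ℓ p : ℕ) [NeZero p] : ℕ :=
  Finset.univ.sup fun a : ZMod p => preperiod (chebMap ℓ p) a

/-- The order of `p` in `(ℤ/ℓℤ)ˣ / {±1}`. -/
def chebMu (ℓ p : ℕ) (h : p.Coprime ℓ) : ℕ :=
  orderOf (QuotientGroup.mk (ZMod.unitOfCoprime p h) :
    (ZMod ℓ)ˣ ⧸ Subgroup.zpowers (-1 : (ZMod ℓ)ˣ))

/-- The member of `{p ^ μ - 1, p ^ μ + 1}` with the larger `ℓ`-adic valuation. -/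
def chebD₁ (ℓ p μ : ℕ) : ℕ :=
  if padicValNat ℓ (p ^ μ - 1) < padicValNat ℓ (p ^ μ + 1) then p ^ μ + 1 else p ^ μ - 1

/-- The member of `{p ^ μ - 1, p ^ μ + 1}` with the smaller `ℓ`-adic valuation. -/
def chebD₂ (ℓ p μ : ℕ) : ℕ :=
  if padicValNat ℓ (p ^ μ - 1) < padicValNat ℓ (p ^ μ + 1) then p ^ μ - 1 else p ^ μ + 1

/-- The cycle of `T_ℓ` on `𝔽_p` into which the orbit of `a` runs corresponds to a divisor of `D`:
the orbit enters the cycle at `c = T_ℓ^ρ(a)`, where `ρ` is the preperiod of `a`, and if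
`c = α + α⁻¹` then the multiplicative order of `α` divides `D`. (The other choice of `α` is `α⁻¹`,
of the same order. For periodic `a` one has `c = a`.) -/
def CycleDivides (ℓ p : ℕ) [Fact p.Prime] (a : ZMod p) (D : ℕ) : Prop :=
  ∃ α : (AlgebraicClosure (ZMod p))ˣ,
    ((α : AlgebraicClosure (ZMod p)) + ((α⁻¹ : (AlgebraicClosure (ZMod p))ˣ) : _) =
      algebraMap (ZMod p) (AlgebraicClosure (ZMod p))
        ((chebMap ℓ p)^[preperiod (chebMap ℓ p) a] a)) ∧
    orderOf α ∣ D

/-- The reduction modulo `p` of `T_ℓ^n(x) - t ∈ ℤ[x]`. -/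
def chebRed (ℓ p n : ℕ) (t : ℤ) : (ZMod p)[X] :=
  (chebIter ℤ ℓ n - C t).map (Int.castRingHom (ZMod p))

/-- The factorization type of a nonzero polynomial over a field: the multiset with one entry
`(degree, multiplicity)` for each distinct monic irreducible factor. -/
def factType {K : Type*} [Field K] [DecidableEq K] (f : K[X]) : Multiset (ℕ × ℕ) :=
  (UniqueFactorizationMonoid.normalizedFactors f).toFinset.val.map fun g =>
    (g.natDegree, (UniqueFactorizationMonoid.normalizedFactors f).count g)

end

/-!
Let `L` be an algebraic closure of `𝔽_p` and write `a = α + α⁻¹` for the reduction `a` of `t`. Since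
the `n`-fold iterate of `T_ℓ` is `T_N` with `N = ℓ ^ n`, and `T_N (z + z⁻¹) = z ^ N + z⁻¹ ^ N`, one
has `T_N - a = ∏ (X - (b + b⁻¹))` over the `N`-th roots `b` of `α` in `L`
(`chebyshevC_sub_C_eq_prod`). So everything is read off from the orders of the `b`.

* The degree of `b + b⁻¹` over `𝔽_p` is the least `d ≥ 1` such that the order of `b` divides
  `p ^ d - 1` or `p ^ d + 1` (`natDegree_minpoly_add_inv_dvd_iff`).
* Its multiplicity is the number of `N`-th roots of `α` among `b`, `b⁻¹`: it is `1` unless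
  `α ^ 2 = 1`, that is `a = 2` or `a = -2`, and then it is `2` except at the roots with `b ^ 2 = 1`.
* If `α` has order `ℓ ^ r * m` with `m` prime to `ℓ`, then `r` is the preperiod of `a`
  (`preperiod_chebMap_eq`) and `m` is the order attached to its cycle. For `r > 0` all `b` have
  order `ℓ ^ (n + r) * m`; for `r = 0` there are `φ (ℓ ^ k)` of order `ℓ ^ k * m` for each `k ≤ n`.

The least `d` for an order `ℓ ^ k * m` comes from the lifting-the-exponent lemma. When `2 < ℓ ^ k`,
`p ^ d` is a sign modulo `ℓ ^ k` if and only if `μ * ℓ ^ (k - v)` divides `d`, and the sign is then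
`σ ^ (d / μ)`, where `D₁ = p ^ μ - σ` (`SignData`, `exists_signData`). If `m` divides `D₁`, then
`p ^ d` is the same sign modulo `m`; if `m > 2` divides `D₂`, the two signs agree only for even
`d / μ`. Finally, the factorization type is determined by the number of roots of each degree and
multiplicity (`factType_eq_sum_replicate`).
-/

/-! ### Factorization types from roots -/

open UniqueFactorizationMonoid in
/-- A distinct factor of degree `d` and multiplicity `m` contributes `d * m` roots, counted with
multiplicity, and these are the roots of degree `d` and multiplicity `m` having that factor as
minimal polynomial. -/
theorem mul_count_factType {K L : Type*} [Field K] [DecidableEq K] [PerfectField K] [Field L]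
    [DecidableEq L] [IsAlgClosed L] [Algebra K L] {f : K[X]} (hf : f.Monic) (d m : ℕ) :
    d * m * (factType f).count (d, m) =
      ((f.aroots L).filter fun x =>
        (minpoly K x).natDegree = d ∧ (f.aroots L).count x = m).card := by
  classical
  set nf := normalizedFactors f with hnf
  have hirr : ∀ g ∈ nf, Irreducible g := fun g hg => irreducible_of_normalized_factor g hg
  have hmon : ∀ g ∈ nf, g.Monic := fun g hg => by
    have := normalize_normalized_factor g hg
    rw [← this]
    exact Polynomial.monic_normalize (hirr g hg).ne_zero
  have hprod : nf.prod = f := by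
    rw [hnf, prod_normalizedFactors_eq hf.ne_zero, hf.normalize_eq_self]
  have hroots : f.aroots L = nf.bind fun g => g.aroots L := by
    rw [← hprod, aroots_def, Polynomial.map_multiset_prod, roots_multiset_prod,
      Multiset.bind_map]
    simp only [Multiset.mem_map, not_exists, not_and]
    intro g hg h0
    exact ((hmon g hg).map (algebraMap K L)).ne_zero h0
  have hmin : ∀ g ∈ nf, ∀ x ∈ g.aroots L, minpoly K x = g := fun g hg x hx =>
    (minpoly.eq_of_irreducible_of_monic (hirr g hg) (mem_aroots.1 hx).2 (hmon g hg)).symm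
  have hnodup : ∀ g ∈ nf, (g.aroots L).Nodup := fun g hg =>
    nodup_roots (PerfectField.separable_of_irreducible (hirr g hg)).map
  have hcard : ∀ g ∈ nf, (g.aroots L).card = g.natDegree := fun g _ =>
    IsAlgClosed.card_aroots_eq_natDegree
  have hcount : ∀ g ∈ nf, ∀ x ∈ g.aroots L, (f.aroots L).count x = nf.count g := by
    intro g hg x hx
    have hsum : ∀ s : Multiset K[X], s.count g = (s.map fun g' => if g = g' then 1 else 0).sum :=
      fun s => s.induction_on (by simp) fun a s ih => by
        rw [Multiset.count_cons, Multiset.map_cons, Multiset.sum_cons, ih, add_comm]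
    rw [hroots, Multiset.count_bind, hsum]
    refine congrArg _ (Multiset.map_congr rfl fun g' hg' => ?_)
    split_ifs with h
    · subst h
      exact Multiset.count_eq_one_of_mem (hnodup _ hg) hx
    · rw [Multiset.count_eq_zero]
      intro hx'
      exact h ((hmin g hg x hx).symm.trans (hmin g' hg' x hx'))
  have hfil : ((f.aroots L).filter fun x =>
        (minpoly K x).natDegree = d ∧ (f.aroots L).count x = m).card =
      (nf.map fun g => if g.natDegree = d ∧ nf.count g = m then d else 0).sum := by
    rw [congrArg (Multiset.filter _) hroots, Multiset.filter_bind, Multiset.card_bind]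
    refine congrArg _ (Multiset.map_congr rfl fun g hg => ?_)
    simp only [Function.comp]
    split_ifs with h
    · rw [Multiset.filter_eq_self.2, hcard g hg, h.1]
      intro x hx
      rw [hmin g hg x hx, hcount g hg x hx]
      exact h
    · rw [Multiset.filter_eq_nil.2, Multiset.card_zero]
      intro x hx
      rw [hmin g hg x hx, hcount g hg x hx]
      exact h
  rw [hfil, Finset.sum_multiset_map_count, factType, Multiset.count_map]
  have : ∀ g ∈ nf.toFinset, nf.count g • (if g.natDegree = d ∧ nf.count g = m then d else 0) =
      if g.natDegree = d ∧ nf.count g = m then d * m else 0 := by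
    intro g _
    split_ifs with h
    · rw [h.2, smul_eq_mul, mul_comm]
    · simp
  rw [Finset.sum_congr rfl this, ← Finset.sum_filter, Finset.sum_const, smul_eq_mul, mul_comm]
  congr 1
  rw [Finset.card_def, Finset.filter_val]
  refine congrArg _ (Multiset.filter_congr fun g _ => ?_)
  rw [Prod.mk.injEq, eq_comm, eq_comm (a := m)]

open UniqueFactorizationMonoid in
theorem pos_of_mem_factType {K : Type*} [Field K] [DecidableEq K] {f : K[X]} {x : ℕ × ℕ}
    (hx : x ∈ factType f) : 0 < x.1 ∧ 0 < x.2 := by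
  rw [factType, Multiset.mem_map] at hx
  obtain ⟨g, hg, rfl⟩ := hx
  rw [Finset.mem_val, Multiset.mem_toFinset] at hg
  exact ⟨(irreducible_of_normalized_factor g hg).natDegree_pos, Multiset.count_pos.2 hg⟩

/-- If the roots of `f` are listed by `φ : B → L` and `B` is cut into classes on which the degree
`d i` of the root and the size `m i` of the fibre of `φ` are constant, a class of `d i * m i * c i`
elements accounts for `c i` factors of degree `d i` and multiplicity `m i`. A class need not be
closed under conjugation: only its size enters. -/
theorem factType_eq_sum_replicate {K L ι β : Type*} [Field K] [DecidableEq K] [PerfectField K]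
    [Field L] [DecidableEq L] [IsAlgClosed L] [Algebra K L] [DecidableEq ι]
    {f : K[X]} (hf : f.Monic) {B : Finset β} {φ : β → L} (hroots : f.aroots L = B.val.map φ)
    {I : Finset ι} {cls : β → ι} (hcls : ∀ b ∈ B, cls b ∈ I) (d m c : ι → ℕ)
    (hpos : ∀ i ∈ I, 0 < d i ∧ 0 < m i)
    (hd : ∀ b ∈ B, (minpoly K (φ b)).natDegree = d (cls b))
    (hm : ∀ b ∈ B, (B.filter fun b' => φ b' = φ b).card = m (cls b))
    (hc : ∀ i ∈ I, (B.filter fun b => cls b = i).card = d i * m i * c i) :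
    factType f = ∑ i ∈ I, Multiset.replicate (c i) (d i, m i) := by
  classical
  ext ⟨d₀, m₀⟩
  by_cases h0 : d₀ = 0 ∨ m₀ = 0
  · rw [Multiset.count_eq_zero.2, Multiset.count_eq_zero.2]
    · intro h
      obtain ⟨i, hi, h⟩ := Multiset.mem_sum.1 h
      obtain ⟨rfl, rfl⟩ := Prod.mk.inj (Multiset.eq_of_mem_replicate h)
      have := hpos i hi
      omega
    · intro h
      have := pos_of_mem_factType h
      simp only at this
      omega
  push Not at h0
  refine Nat.eq_of_mul_eq_mul_left (Nat.mul_pos (Nat.pos_of_ne_zero h0.1)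
    (Nat.pos_of_ne_zero h0.2)) ?_
  rw [mul_count_factType (L := L) hf, Multiset.count_sum', Finset.mul_sum]
  have h1 : ∀ b ∈ B, (f.aroots L).count (φ b) = m (cls b) := by
    intro b hb
    rw [hroots, Multiset.count_map, ← hm b hb, Finset.card_def, Finset.filter_val]
    exact congrArg _ (Multiset.filter_congr fun _ _ => eq_comm)
  have h2 : ((f.aroots L).filter fun x =>
        (minpoly K x).natDegree = d₀ ∧ (f.aroots L).count x = m₀).card =
      (B.filter fun b => d (cls b) = d₀ ∧ m (cls b) = m₀).card := by
    rw [congrArg (Multiset.filter _) hroots, Multiset.filter_map, Multiset.card_map,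
      Finset.card_def, Finset.filter_val]
    refine congrArg _ (Multiset.filter_congr fun b hb => ?_)
    simp only [Function.comp]
    rw [hd b hb, h1 b hb]
  rw [h2, Finset.card_eq_sum_card_fiberwise (f := cls) (t := I)
    (fun b hb => hcls b (Finset.mem_filter.1 hb).1)]
  refine Finset.sum_congr rfl fun i hi => ?_
  rw [Multiset.count_replicate]
  split_ifs with h
  · obtain ⟨rfl, rfl⟩ := Prod.mk.inj h
    rw [← hc i hi]
    congr 1
    ext b
    simp only [Finset.mem_filter]
    constructor
    · rintro ⟨⟨h1, -⟩, h2⟩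
      exact ⟨h1, h2⟩
    · rintro ⟨h1, rfl⟩
      exact ⟨⟨h1, rfl, rfl⟩, rfl⟩
  · rw [mul_zero, Finset.card_eq_zero, Finset.filter_eq_empty_iff]
    rintro b hb rfl
    exact h (Prod.ext (Finset.mem_filter.1 hb).2.1 (Finset.mem_filter.1 hb).2.2)

open UniqueFactorizationMonoid in
theorem irreducible_of_factType_eq {K : Type*} [Field K] [DecidableEq K] {f : K[X]} (hf : f ≠ 0)
    {d : ℕ} (h : factType f = {(d, 1)}) : Irreducible f := by
  obtain ⟨g, hg, hgd⟩ := Multiset.map_eq_singleton.1 h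
  have hg1 := (Prod.mk.inj hgd).2
  have hgn : (normalizedFactors f).Nodup := by
    rw [Multiset.nodup_iff_count_le_one]
    intro x
    by_cases hx : x ∈ normalizedFactors f
    · have : x ∈ (normalizedFactors f).toFinset.val  :=
        Multiset.mem_toFinset.2 hx
      rw [hg, Multiset.mem_singleton] at this
      rw [this, hg1]
    · rw [Multiset.count_eq_zero.2 hx]
      exact Nat.zero_le _
  rw [Multiset.toFinset_val, hgn.dedup] at hg
  have := prod_normalizedFactors hf
  rw [hg, Multiset.prod_singleton] at this
  refine this.irreducible (irreducible_of_normalized_factor (a := f) g ?_)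
  rw [hg]; exact Multiset.mem_singleton_self g

open UniqueFactorizationMonoid in
theorem splits_of_factType_degree_one {K : Type*} [Field K] [DecidableEq K] {f : K[X]}
    (hf : f ≠ 0) (h : ∀ x ∈ factType f, x.1 = 1) : f.Splits := by
  have hs : (normalizedFactors f).prod.Splits := by
    refine Splits.multisetProd fun g hg => Splits.of_natDegree_eq_one ?_
    exact h _ (Multiset.mem_map_of_mem _ (Multiset.mem_toFinset.2 hg))
  have := prod_normalizedFactors hf
  exact hs.of_dvd (this.symm.ne_zero_iff.1 hf) this.symm.dvd

/-! ### Roots of `T_N - a` and their degrees -/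

theorem chebIter_eq (R : Type*) [CommRing R] (ℓ n : ℕ) :
    chebIter R ℓ n = Chebyshev.C R ((ℓ ^ n : ℕ) : ℤ) := by
  induction n with
  | zero => simp [chebIter]
  | succ n ih =>
    rw [chebIter, Function.iterate_succ_apply', ← chebIter, ih, chebT, ← Chebyshev.C_mul, pow_succ']
    push_cast
    rfl

theorem chebRed_eq (ℓ p n : ℕ) (t : ℤ) :
    chebRed ℓ p n t = Chebyshev.C (ZMod p) ((ℓ ^ n : ℕ) : ℤ) - C (t : ZMod p) := by
  rw [chebRed, chebIter_eq, Polynomial.map_sub, Chebyshev.map_C, map_C, eq_intCast]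

theorem chebyshevC_eval_add {R : Type*} [CommRing R] {z w : R} (h : z * w = 1) (n : ℕ) :
    (Chebyshev.C R (n : ℤ)).eval (z + w) = z ^ n + w ^ n := by
  induction n using Nat.twoStepInduction with
  | zero => simp; norm_num
  | one => simp
  | more n ih₁ ih₂ =>
    rw [show ((n + 2 : ℕ) : ℤ) = (n : ℤ) + 2 by push_cast; ring, Chebyshev.C_add_two, eval_sub,
      eval_mul, eval_X, ih₁, show ((n : ℤ) + 1) = ((n + 1 : ℕ) : ℤ) by push_cast; ring, ih₂]
    linear_combination (z ^ n + w ^ n) * h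

section Field

variable {L : Type*} [Field L]

theorem inv_mem_nthRootsFinset_inv {N : ℕ} (hN : 0 < N) {α b : L} :
    b⁻¹ ∈ nthRootsFinset N α⁻¹ ↔ b ∈ nthRootsFinset N α := by
  rw [mem_nthRootsFinset hN, mem_nthRootsFinset hN, inv_pow, inv_inj]

theorem add_inv_eq_add_inv_iff {b c : L} (hb : b ≠ 0) (hc : c ≠ 0) :
    b + b⁻¹ = c + c⁻¹ ↔ b = c ∨ b = c⁻¹ := by
  have : b + b⁻¹ - (c + c⁻¹) = (b - c) * (b - c⁻¹) * b⁻¹ := by field_simp; ring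
  rw [← sub_eq_zero, this]
  simp [hb, sub_eq_zero]

theorem card_fiber_eq_one [DecidableEq L] {N : ℕ} (hN : 0 < N) {α : L} (hα : α ≠ 0)
    (hα2 : α ^ 2 ≠ 1) {b : L} (hb : b ∈ nthRootsFinset N α) :
    ((nthRootsFinset N α).filter fun b' => b' + b'⁻¹ = b + b⁻¹).card = 1 := by
  rw [Finset.card_eq_one]
  refine ⟨b, Finset.ext fun c => ?_⟩
  rw [Finset.mem_filter, Finset.mem_singleton]
  constructor
  · rintro ⟨hc, h⟩
    refine ((add_inv_eq_add_inv_iff (ne_zero_of_mem_nthRootsFinset hα hc)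
      (ne_zero_of_mem_nthRootsFinset hα hb)).1 h).resolve_right ?_
    rintro rfl
    rw [mem_nthRootsFinset hN] at hb hc
    rw [inv_pow, hb] at hc
    apply hα2
    rw [sq]
    nth_rw 1 [← hc]
    exact inv_mul_cancel₀ hα
  · rintro rfl
    exact ⟨hb, rfl⟩

/-- When `α ^ 2 = 1`, the `N`-th roots of `α` are stable under inversion. -/
theorem filter_fiber_eq_pair [DecidableEq L] {N : ℕ} (hN : 0 < N) {α : L} (hα : α ≠ 0)
    (hα2 : α ^ 2 = 1) {b : L} (hb : b ∈ nthRootsFinset N α) :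
    ((nthRootsFinset N α).filter fun b' => b' + b'⁻¹ = b + b⁻¹) = {b, b⁻¹} := by
  have hinv : α⁻¹ = α := by
    exact inv_eq_of_mul_eq_one_left (by rw [← sq, hα2])
  ext c
  rw [Finset.mem_filter, Finset.mem_insert, Finset.mem_singleton]
  have hb' : b⁻¹ ∈ nthRootsFinset N α := by
    rw [← inv_mem_nthRootsFinset_inv hN, inv_inv, hinv]
    exact hb
  constructor
  · rintro ⟨hc, h⟩
    exact (add_inv_eq_add_inv_iff (ne_zero_of_mem_nthRootsFinset hα hc)
      (ne_zero_of_mem_nthRootsFinset hα hb)).1 h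
  · rintro (rfl | rfl)
    · exact ⟨hb, rfl⟩
    · exact ⟨hb', by rw [inv_inv, add_comm]⟩

theorem card_fiber_eq_ite [DecidableEq L] {N : ℕ} (hN : 0 < N) {α : L} (hα : α ≠ 0)
    (hα2 : α ^ 2 = 1) {b : L} (hb : b ∈ nthRootsFinset N α) :
    ((nthRootsFinset N α).filter fun b' => b' + b'⁻¹ = b + b⁻¹).card =
      if b ^ 2 = 1 then 1 else 2 := by
  have hb0 := ne_zero_of_mem_nthRootsFinset hα hb
  rw [filter_fiber_eq_pair hN hα hα2 hb]
  split_ifs with h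
  · have : b⁻¹ = b := inv_eq_of_mul_eq_one_left (by rw [← sq, h])
    rw [this]
    simp
  · refine Finset.card_pair fun hbb => h ?_
    rw [sq]
    nth_rw 1 [hbb]
    exact inv_mul_cancel₀ hb0

end Field

section AlgClosed

variable {L : Type*} [Field L] [IsAlgClosed L]

theorem exists_add_inv_eq (y : L) : ∃ z : L, z ≠ 0 ∧ z + z⁻¹ = y := by
  obtain ⟨z, hz⟩ := IsAlgClosed.exists_root (X ^ 2 - C y * X + 1 : L[X]) (by
    rw [show (X ^ 2 - C y * X + 1 : L[X]) = C 1 * X ^ 2 + C (-y) * X + C 1 by simp; ring,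
      degree_quadratic one_ne_zero]
    decide)
  have hz' : z ^ 2 - y * z + 1 = 0 := by simpa using hz
  have h0 : z ≠ 0 := by
    rintro rfl
    simp at hz'
  refine ⟨z, h0, ?_⟩
  field_simp
  linear_combination hz'

theorem prod_nthRootsFinset_sub {N : ℕ} (hN : (N : L) ≠ 0) {α : L} (hα : α ≠ 0) (z : L) :
    ∏ b ∈ nthRootsFinset N α, (z - b) = z ^ N - α := by
  classical
  have hN0 : 0 < N := Nat.pos_of_ne_zero (by rintro rfl; simp at hN)
  have h := (IsAlgClosed.splits (X ^ N - C α)).eq_prod_roots_of_monic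
    (monic_X_pow_sub_C α hN0.ne')
  have hnd : (X ^ N - C α).roots.Nodup := nodup_roots (separable_X_pow_sub_C α hN hα)
  have h2 := congrArg (eval z) h
  rw [eval_sub, eval_pow, eval_X, eval_C, eval_multiset_prod, Multiset.map_map] at h2
  rw [h2, Finset.prod, nthRootsFinset_def, Multiset.toFinset_val, nthRoots, hnd.dedup]
  simp

theorem card_nthRootsFinset_eq {N : ℕ} (hN : (N : L) ≠ 0) {α : L} (hα : α ≠ 0) :
    (nthRootsFinset N α).card = N := by
  classical
  have hnd : (X ^ N - C α).roots.Nodup := nodup_roots (separable_X_pow_sub_C α hN hα)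
  rw [nthRootsFinset_def, Finset.card_def, Multiset.toFinset_val, nthRoots, hnd.dedup,
    splits_iff_card_roots.1 (IsAlgClosed.splits _), natDegree_X_pow_sub_C]

/-- `C_N - (α + α⁻¹)` is the product of the `X - (b + b⁻¹)` over the `N`-th roots `b` of `α`: at
`z + z⁻¹` both sides are `(z ^ N - α) * (z ^ N - α⁻¹) * z⁻¹ ^ N`. -/
theorem chebyshevC_sub_C_eq_prod {N : ℕ} (hN : (N : L) ≠ 0) {α : L} (hα : α ≠ 0) :
    Chebyshev.C L (N : ℤ) - C (α + α⁻¹) =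
      ∏ b ∈ nthRootsFinset N α, (X - C (b + b⁻¹)) := by
  have hN0 : 0 < N := Nat.pos_of_ne_zero (by rintro rfl; simp at hN)
  refine Polynomial.funext fun y => ?_
  obtain ⟨z, hz, rfl⟩ := exists_add_inv_eq y
  rw [eval_sub, eval_C, chebyshevC_eval_add (mul_inv_cancel₀ hz), eval_prod]
  have h1 : ∀ b ∈ nthRootsFinset N α, eval (z + z⁻¹) (X - C (b + b⁻¹)) =
      (z - b) * (z - b⁻¹) * z⁻¹ := by
    intro b hb
    have hb0 := ne_zero_of_mem_nthRootsFinset hα hb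
    rw [eval_sub, eval_X, eval_C]
    field_simp
    ring
  have h2 : ∏ b ∈ nthRootsFinset N α, (z - b⁻¹) = ∏ b ∈ nthRootsFinset N α⁻¹, (z - b) := by
    refine Finset.prod_bij' (fun b _ => b⁻¹) (fun b _ => b⁻¹)
      (fun b hb => (inv_mem_nthRootsFinset_inv hN0).2 hb)
      (fun b hb => (inv_mem_nthRootsFinset_inv hN0).1 (by rwa [inv_inv])) ?_ ?_ ?_ <;> simp
  rw [Finset.prod_congr rfl h1, Finset.prod_mul_distrib, Finset.prod_mul_distrib, h2,
    prod_nthRootsFinset_sub hN hα, prod_nthRootsFinset_sub hN (inv_ne_zero hα), Finset.prod_const,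
    card_nthRootsFinset_eq hN hα, inv_pow]
  have hzN : z ^ N ≠ 0 := pow_ne_zero _ hz
  field_simp
  ring

variable {K : Type*} [Field K] [Algebra K L]

theorem map_chebyshevC_sub_C {N : ℕ} (hN : (N : L) ≠ 0) {α : L} (hα : α ≠ 0) {a : K}
    (ha : algebraMap K L a = α + α⁻¹) :
    (Chebyshev.C K (N : ℤ) - C a).map (algebraMap K L) =
      ∏ b ∈ nthRootsFinset N α, (X - C (b + b⁻¹)) := by
  rw [Polynomial.map_sub, Chebyshev.map_C, map_C, ha, chebyshevC_sub_C_eq_prod hN hα]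

theorem monic_chebyshevC_sub_C {N : ℕ} (hN : (N : L) ≠ 0) {α : L} (hα : α ≠ 0) {a : K}
    (ha : algebraMap K L a = α + α⁻¹) : (Chebyshev.C K (N : ℤ) - C a).Monic := by
  refine monic_of_injective (algebraMap K L).injective ?_
  rw [map_chebyshevC_sub_C hN hα ha]
  exact monic_prod_of_monic _ _ fun b _ => monic_X_sub_C _

theorem aroots_chebyshevC_sub_C {N : ℕ} (hN : (N : L) ≠ 0) {α : L} (hα : α ≠ 0) {a : K}
    (ha : algebraMap K L a = α + α⁻¹) :
    (Chebyshev.C K (N : ℤ) - C a).aroots L =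
      (nthRootsFinset N α).val.map fun b => b + b⁻¹ := by
  rw [aroots_def, map_chebyshevC_sub_C hN hα ha, Finset.prod]
  convert roots_multiset_prod_X_sub_C ((nthRootsFinset N α).val.map fun b => b + b⁻¹) using 3
  rw [Multiset.map_map]
  rfl

end AlgClosed

theorem natDegree_minpoly_dvd_iff {K L : Type*} [Field K] [Finite K] [Field L] [Algebra K L]
    {x : L} (hx : IsIntegral K x) (d : ℕ) :
    (minpoly K x).natDegree ∣ d ↔ x ^ Nat.card K ^ d = x := by
  rw [(minpoly.irreducible hx).natDegree_dvd_iff_dvd_X_pow_card_pow_sub_X, minpoly.dvd_iff]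
  simp [sub_eq_zero]

theorem pow_eq_pow_iff_orderOf_dvd {L : Type*} [Field L] {α : L} (hα : α ≠ 0) (A B : ℕ) :
    α ^ A = α ^ B ↔ (orderOf α : ℤ) ∣ (A : ℤ) - B := by
  lift α to Lˣ using isUnit_iff_ne_zero.2 hα
  rw [orderOf_units, orderOf_dvd_iff_zpow_eq_one, zpow_sub, mul_inv_eq_one, zpow_natCast,
    zpow_natCast, ← Units.val_pow_eq_pow_val, ← Units.val_pow_eq_pow_val, Units.val_inj]

theorem pow_eq_pow_inv_iff_orderOf_dvd {L : Type*} [Field L] {α : L} (hα : α ≠ 0) (A B : ℕ) :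
    α ^ A = (α ^ B)⁻¹ ↔ (orderOf α : ℤ) ∣ (A : ℤ) - (-B) := by
  lift α to Lˣ using isUnit_iff_ne_zero.2 hα
  rw [orderOf_units, orderOf_dvd_iff_zpow_eq_one, zpow_sub, mul_inv_eq_one, zpow_neg, zpow_natCast,
    zpow_natCast, ← Units.val_pow_eq_pow_val, ← Units.val_pow_eq_pow_val,
    ← Units.val_inv_eq_inv_val, Units.val_inj]

theorem pow_add_inv_eq_iff {L : Type*} [Field L] {α : L} (hα : α ≠ 0) (A B : ℕ) :
    α ^ A + (α ^ A)⁻¹ = α ^ B + (α ^ B)⁻¹ ↔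
      ((orderOf α : ℤ) ∣ (A : ℤ) - B ∨ (orderOf α : ℤ) ∣ (A : ℤ) - (-B)) := by
  rw [add_inv_eq_add_inv_iff (pow_ne_zero _ hα) (pow_ne_zero _ hα),
    pow_eq_pow_iff_orderOf_dvd hα, pow_eq_pow_inv_iff_orderOf_dvd hα]

/-- The Frobenius power `x ↦ x ^ p ^ d` fixes `b + b⁻¹` if and only if it maps `b` to `b` or to
`b⁻¹`. -/
theorem natDegree_minpoly_add_inv_dvd_iff {p : ℕ} [Fact p.Prime] {L : Type*} [Field L]
    [Algebra (ZMod p) L] [Algebra.IsAlgebraic (ZMod p) L] {b : L} (hb : b ≠ 0) (d : ℕ) :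
    (minpoly (ZMod p) (b + b⁻¹)).natDegree ∣ d ↔
      ((orderOf b : ℤ) ∣ (p : ℤ) ^ d - 1 ∨ (orderOf b : ℤ) ∣ (p : ℤ) ^ d - (-1)) := by
  have : CharP L p := charP_of_injective_algebraMap (algebraMap (ZMod p) L).injective p
  have h := pow_add_inv_eq_iff hb (p ^ d) 1
  rw [pow_one, Nat.cast_pow, Nat.cast_one] at h
  rw [natDegree_minpoly_dvd_iff (Algebra.IsIntegral.isIntegral _), Nat.card_zmod,
    add_pow_char_pow, inv_pow, h]

/-! ### Signs of powers of `p` modulo powers of `ℓ` -/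

/-- How `ℓ` divides the numbers `p ^ d ± 1`. The sign `σ` is the one with `D₁ = p ^ μ - σ`, so that
`D₂ = p ^ μ + σ`; `v` plays the part of the `ℓ`-adic valuation of `D₁`. For `2 < ℓ ^ k`, where the
signs `1` and `-1` are distinct modulo `ℓ ^ k`, the field `pow_dvd_iff` says exactly when `p ^ d` is
congruent to a given sign modulo `ℓ ^ k`; the truncated subtraction makes `ℓ ^ (k - v) = 1` for
`k ≤ v`. -/
structure SignData (ℓ p μ v D₁ D₂ : ℕ) (σ : ℤ) : Prop where
  sign : σ = 1 ∨ σ = -1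
  D₁_eq : (D₁ : ℤ) = (p : ℤ) ^ μ - σ
  D₂_eq : (D₂ : ℤ) = (p : ℤ) ^ μ + σ
  μ_pos : 0 < μ
  v_pos : 0 < v
  two_lt : 2 < ℓ ^ v
  μ_eq_one : ℓ = 2 → μ = 1
  two_mul_μ_dvd : ℓ ≠ 2 → 2 * μ ∣ ℓ - 1
  pow_dvd_iff : ∀ (k d : ℕ) (s : ℤ), 2 < ℓ ^ k → (s = 1 ∨ s = -1) →
    ((ℓ : ℤ) ^ k ∣ (p : ℤ) ^ d - s ↔ μ * ℓ ^ (k - v) ∣ d ∧ s = σ ^ (d / μ))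

theorem pow_eq_one_or_neg_one {σ : ℤ} (hσ : σ = 1 ∨ σ = -1) (e : ℕ) : σ ^ e = 1 ∨ σ ^ e = -1 := by
  rcases hσ with rfl | rfl
  · simp
  · exact neg_one_pow_eq_or ℤ e

theorem sign_eq_of_dvd {q x s s' : ℤ} (hq : 2 < q) (hs : s = 1 ∨ s = -1) (hs' : s' = 1 ∨ s' = -1)
    (h : q ∣ x - s) (h' : q ∣ x - s') : s = s' := by
  have h2 := dvd_sub h h'
  rcases hs with rfl | rfl <;> rcases hs' with rfl | rfl
  · rfl
  · have h3 : q ∣ 2 := (dvd_neg.2 h2).trans (by ring_nf; rfl)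
    exact absurd (Int.le_of_dvd (by norm_num) h3) (by omega)
  · have h3 : q ∣ 2 := h2.trans (by ring_nf; rfl)
    exact absurd (Int.le_of_dvd (by norm_num) h3) (by omega)
  · rfl

/-- The exponent `k₀` is the least one with `2 < ℓ ^ k₀`, that is `1` for odd `ℓ` and `2` for
`ℓ = 2`. This is what the lifting-the-exponent lemma needs as its starting congruence. -/
theorem signData_of_base {ℓ p μ k₀ : ℕ} (hℓ : ℓ.Prime) (hp : p.Prime) (hpℓ : p ≠ ℓ) {σ : ℤ}
    (hσ : σ = 1 ∨ σ = -1) (hμ : 0 < μ) (hk₀ : 0 < k₀) (hmin : ∀ k, 2 < ℓ ^ k ↔ k₀ ≤ k)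
    (hdvd : (ℓ : ℤ) ^ k₀ ∣ (p : ℤ) ^ μ - σ)
    (hord : ∀ (d : ℕ) (s : ℤ), (s = 1 ∨ s = -1) → (ℓ : ℤ) ^ k₀ ∣ (p : ℤ) ^ d - s → μ ∣ d)
    (h1 : ℓ = 2 → μ = 1) (h2 : ℓ ≠ 2 → 2 * μ ∣ ℓ - 1) :
    SignData ℓ p μ (padicValNat ℓ (chebD₁ ℓ p μ)) (chebD₁ ℓ p μ) (chebD₂ ℓ p μ) σ := by
  have := Fact.mk hℓ
  have hq : (2 : ℤ) < (ℓ : ℤ) ^ k₀ := by exact_mod_cast (hmin k₀).2 le_rfl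
  have hpμ : 1 < p ^ μ := Nat.one_lt_pow hμ.ne' hp.one_lt
  have hcast1 : ((p ^ μ - 1 : ℕ) : ℤ) = (p : ℤ) ^ μ - 1 := by
    rw [Nat.cast_sub hpμ.le]; push_cast; rfl
  have hcast2 : ((p ^ μ + 1 : ℕ) : ℤ) = (p : ℤ) ^ μ + 1 := by push_cast; rfl
  have hnd : ¬ (ℓ : ℤ) ^ k₀ ∣ (p : ℤ) ^ μ + σ := by
    intro h
    have := sign_eq_of_dvd hq hσ (s' := -σ) (by rcases hσ with rfl | rfl <;> simp) hdvd
      (by rwa [sub_neg_eq_add])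
    rcases hσ with rfl | rfl <;> norm_num at this
  have hpz : ∀ D : ℕ, D ≠ 0 → ((ℓ : ℤ) ^ k₀ ∣ (D : ℤ) ↔ k₀ ≤ padicValNat ℓ D) := fun D hD => by
    rw [← Nat.cast_pow, Int.natCast_dvd_natCast, padicValNat_dvd_iff_le hD]
  have hD : ((chebD₁ ℓ p μ : ℕ) : ℤ) = (p : ℤ) ^ μ - σ ∧
      ((chebD₂ ℓ p μ : ℕ) : ℤ) = (p : ℤ) ^ μ + σ := by
    have a1 := hpz (p ^ μ - 1) (by omega)
    have a2 := hpz (p ^ μ + 1) (by omega)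
    rw [hcast1] at a1
    rw [hcast2] at a2
    rcases hσ with rfl | rfl
    · rw [a1] at hdvd
      rw [a2] at hnd
      rw [chebD₁, chebD₂, if_neg (by omega), if_neg (by omega)]
      exact ⟨hcast1, hcast2⟩
    · rw [sub_neg_eq_add, a2] at hdvd
      rw [← sub_eq_add_neg, a1] at hnd
      rw [chebD₁, chebD₂, if_pos (by omega), if_pos (by omega)]
      exact ⟨by rw [hcast2]; ring, by rw [hcast1]; ring⟩
  have hD0 : chebD₁ ℓ p μ ≠ 0 := by
    unfold chebD₁; split_ifs <;> omega
  set v := padicValNat ℓ (chebD₁ ℓ p μ) with hv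
  have hkv : k₀ ≤ v := by rw [hv, ← hpz _ hD0, hD.1]; exact hdvd
  have hem : emultiplicity (ℓ : ℤ) ((p : ℤ) ^ μ - σ) = v := by
    rw [← hD.1, Int.natCast_emultiplicity, hv, padicValNat_eq_emultiplicity hD0]
  have hlte : ∀ e : ℕ,
      emultiplicity (ℓ : ℤ) (((p : ℤ) ^ μ) ^ e - σ ^ e) = v + emultiplicity ℓ e := by
    intro e
    have hx : ¬ (ℓ : ℤ) ∣ (p : ℤ) ^ μ := by
      rw [← Nat.cast_pow, Int.natCast_dvd_natCast]
      intro h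
      exact hpℓ ((Nat.prime_dvd_prime_iff_eq hℓ hp).1 (hℓ.dvd_of_dvd_pow h)).symm
    rcases hℓ.eq_two_or_odd' with rfl | hodd
    · have : k₀ = 2 := by
        have h1 := hmin 1
        have h2 := hmin 2
        norm_num at h1 h2
        omega
      subst this
      rw [← hem, ← Int.natCast_emultiplicity]
      exact Int.two_pow_sub_pow' e (by simpa using hdvd) hx
    · rw [← hem]
      exact Int.emultiplicity_pow_sub_pow hℓ hodd ((dvd_pow_self _ hk₀.ne').trans hdvd) hx e
  refine ⟨hσ, hD.1, hD.2, hμ, hk₀.trans_le hkv, (hmin v).2 hkv, h1, h2, ?_⟩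
  intro k d s hk hs
  have hk' := (hmin k).1 hk
  have key : ∀ e : ℕ, (ℓ : ℤ) ^ k ∣ (p : ℤ) ^ (μ * e) - σ ^ e ↔ ℓ ^ (k - v) ∣ e := by
    intro e
    rw [pow_mul, pow_dvd_iff_le_emultiplicity, hlte, pow_dvd_iff_le_emultiplicity, ENat.natCast_sub,
      tsub_le_iff_left]
  constructor
  · intro h
    have h' := (pow_dvd_pow (ℓ : ℤ) hk').trans h
    obtain ⟨e, rfl⟩ := hord d s hs h'
    have hse : s = σ ^ e := by
      refine sign_eq_of_dvd hq hs (pow_eq_one_or_neg_one hσ e) h' ?_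
      rw [pow_mul]
      exact hdvd.trans (sub_dvd_pow_sub_pow _ _ e)
    rw [Nat.mul_div_cancel_left _ hμ]
    rw [hse, key] at h
    exact ⟨Nat.mul_dvd_mul_left μ h, hse⟩
  · rintro ⟨h, rfl⟩
    obtain ⟨e, rfl⟩ := (dvd_mul_right _ _).trans h
    rw [Nat.mul_div_cancel_left _ hμ, key]
    exact Nat.dvd_of_mul_dvd_mul_left hμ h

theorem chebMu_dvd_iff {ℓ p : ℕ} (h : p.Coprime ℓ) (d : ℕ) :
    chebMu ℓ p h ∣ d ↔ (ℓ : ℤ) ∣ (p : ℤ) ^ d - 1 ∨ (ℓ : ℤ) ∣ (p : ℤ) ^ d - (-1) := by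
  rw [chebMu, orderOf_dvd_iff_pow_eq_one, ← QuotientGroup.mk_pow, QuotientGroup.eq_one_iff]
  have hz : ∀ u : (ZMod ℓ)ˣ, u ∈ Subgroup.zpowers (-1 : (ZMod ℓ)ˣ) ↔ u = 1 ∨ u = -1 := by
    intro u
    rw [Subgroup.mem_zpowers_iff]
    constructor
    · rintro ⟨k, rfl⟩
      rcases Int.even_or_odd k with hk | hk
      · left; exact hk.neg_one_zpow
      · right; exact hk.neg_one_zpow
    · rintro (rfl | rfl)
      · exact ⟨0, zpow_zero _⟩
      · exact ⟨1, zpow_one _⟩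
  rw [hz, Units.ext_iff, Units.ext_iff, ← ZMod.intCast_zmod_eq_zero_iff_dvd,
    ← ZMod.intCast_zmod_eq_zero_iff_dvd]
  push_cast
  rw [ZMod.coe_unitOfCoprime, sub_eq_zero, sub_eq_zero]

theorem chebMu_pos {ℓ p : ℕ} [NeZero ℓ] (h : p.Coprime ℓ) : 0 < chebMu ℓ p h := by
  rw [chebMu]
  exact orderOf_pos (QuotientGroup.mk (ZMod.unitOfCoprime p h) :
    (ZMod ℓ)ˣ ⧸ Subgroup.zpowers (-1 : (ZMod ℓ)ˣ))

theorem two_mul_chebMu_dvd {ℓ p : ℕ} (hℓ : ℓ.Prime) (hℓ2 : ℓ ≠ 2) (h : p.Coprime ℓ) :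
    2 * chebMu ℓ p h ∣ ℓ - 1 := by
  have := Fact.mk hℓ
  have h1 := Subgroup.card_eq_card_quotient_mul_card_subgroup (Subgroup.zpowers (-1 : (ZMod ℓ)ˣ))
  rw [Nat.card_zpowers, Nat.card_eq_fintype_card, ZMod.card_units] at h1
  have h2 : orderOf (-1 : (ZMod ℓ)ˣ) = 2 := by
    rw [← orderOf_units, Units.val_neg, Units.val_one, orderOf_neg_one, ZMod.ringChar_zmod_n,
      if_neg hℓ2]
  rw [h1, h2, mul_comm]
  exact Nat.mul_dvd_mul_right (orderOf_dvd_natCard _) 2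

theorem exists_signData {ℓ p : ℕ} (hℓ : ℓ.Prime) (hp : p.Prime) (hpℓ : p ≠ ℓ) :
    ∃ σ : ℤ, SignData ℓ p (chebMu ℓ p ((Nat.coprime_primes hp hℓ).2 hpℓ))
      (padicValNat ℓ (chebD₁ ℓ p (chebMu ℓ p ((Nat.coprime_primes hp hℓ).2 hpℓ))))
      (chebD₁ ℓ p (chebMu ℓ p ((Nat.coprime_primes hp hℓ).2 hpℓ)))
      (chebD₂ ℓ p (chebMu ℓ p ((Nat.coprime_primes hp hℓ).2 hpℓ))) σ := by
  set hc := (Nat.coprime_primes hp hℓ).2 hpℓ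
  have : NeZero ℓ := ⟨hℓ.ne_zero⟩
  rcases eq_or_ne ℓ 2 with rfl | hℓ2
  · have hμ : chebMu 2 p hc = 1 := by
      rw [← Nat.dvd_one, chebMu_dvd_iff]
      left
      have := hp.eq_two_or_odd.resolve_left hpℓ
      rw [pow_one]
      push_cast
      omega
    have hodd := hp.eq_two_or_odd.resolve_left hpℓ
    obtain ⟨σ, hσ, hd⟩ : ∃ σ : ℤ, (σ = 1 ∨ σ = -1) ∧ (4 : ℤ) ∣ (p : ℤ) - σ := by
      rcases (by omega : p % 4 = 1 ∨ p % 4 = 3) with h | h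
      · exact ⟨1, Or.inl rfl, by omega⟩
      · exact ⟨-1, Or.inr rfl, by omega⟩
    refine ⟨σ, signData_of_base (k₀ := 2) hℓ hp hpℓ hσ (chebMu_pos hc) two_pos ?_ ?_ ?_
      (fun _ => hμ) (fun h => absurd rfl h)⟩
    · intro k
      exact Nat.pow_lt_pow_iff_right (n := 1) Nat.one_lt_two
    · rw [hμ, pow_one]
      exact hd
    · intro d s _ _
      rw [hμ]
      exact one_dvd d
  · obtain ⟨σ, hσ, hd⟩ : ∃ σ : ℤ, (σ = 1 ∨ σ = -1) ∧ (ℓ : ℤ) ∣ (p : ℤ) ^ chebMu ℓ p hc - σ := by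
      rcases (chebMu_dvd_iff hc _).1 dvd_rfl with h | h
      · exact ⟨1, Or.inl rfl, h⟩
      · exact ⟨-1, Or.inr rfl, h⟩
    refine ⟨σ, signData_of_base (k₀ := 1) hℓ hp hpℓ hσ (chebMu_pos hc) one_pos ?_ ?_ ?_
      (fun h => absurd h hℓ2) (fun _ => two_mul_chebMu_dvd hℓ hℓ2 hc)⟩
    · intro k
      have h3 : 2 < ℓ := lt_of_le_of_ne hℓ.two_le (Ne.symm hℓ2)
      rcases k with _ | k
      · simp
      · have := Nat.le_self_pow (Nat.succ_ne_zero k) ℓ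
        exact ⟨fun _ => Nat.succ_pos k, fun _ => h3.trans_le this⟩
    · rwa [pow_one]
    · intro d s hs h
      rw [chebMu_dvd_iff]
      rw [pow_one] at h
      rcases hs with rfl | rfl
      · exact Or.inl h
      · exact Or.inr h

namespace SignData

variable {ℓ p μ v D₁ D₂ : ℕ} {σ : ℤ}

theorem cast_mul_dvd_iff {k m : ℕ} (hm : (ℓ ^ k).Coprime m) (x : ℤ) :
    ((ℓ ^ k * m : ℕ) : ℤ) ∣ x ↔ (ℓ : ℤ) ^ k ∣ x ∧ (m : ℤ) ∣ x := by
  constructor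
  · intro h
    push_cast at h
    exact ⟨(dvd_mul_right _ _).trans h, (dvd_mul_left _ _).trans h⟩
  · rintro ⟨h1, h2⟩
    push_cast
    refine IsCoprime.mul_dvd ?_ h1 h2
    exact_mod_cast Nat.isCoprime_iff_coprime.2 hm

/-- The sign `σ ^ (d / μ)` forced modulo `ℓ ^ k` is also the right one modulo a divisor of `D₁`. -/
theorem dvd_pow_sub_iff_of_dvd_D₁ (S : SignData ℓ p μ v D₁ D₂ σ) {k m : ℕ} (hk : 2 < ℓ ^ k)
    (hm : (ℓ ^ k).Coprime m) (hmD : m ∣ D₁) (d : ℕ) :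
    (((ℓ ^ k * m : ℕ) : ℤ) ∣ (p : ℤ) ^ d - 1 ∨ ((ℓ ^ k * m : ℕ) : ℤ) ∣ (p : ℤ) ^ d - (-1)) ↔
      μ * ℓ ^ (k - v) ∣ d := by
  have hmD' : (m : ℤ) ∣ (p : ℤ) ^ μ - σ := by
    rw [← S.D₁_eq]
    exact_mod_cast hmD
  rw [cast_mul_dvd_iff hm, cast_mul_dvd_iff hm]
  constructor
  · rintro (h | h)
    · exact ((S.pow_dvd_iff k d 1 hk (Or.inl rfl)).1 h.1).1
    · exact ((S.pow_dvd_iff k d (-1) hk (Or.inr rfl)).1 h.1).1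
  · intro h
    have hms : (m : ℤ) ∣ (p : ℤ) ^ d - σ ^ (d / μ) := by
      obtain ⟨e, rfl⟩ := (dvd_mul_right _ _).trans h
      rw [Nat.mul_div_cancel_left _ S.μ_pos, pow_mul]
      exact hmD'.trans (sub_dvd_pow_sub_pow _ _ e)
    have hs := pow_eq_one_or_neg_one S.sign (d / μ)
    have := (S.pow_dvd_iff k d _ hk hs).2 ⟨h, rfl⟩
    rcases hs with hs | hs <;> rw [hs] at this hms
    · exact Or.inl ⟨this, hms⟩
    · exact Or.inr ⟨this, hms⟩

/-- Modulo `ℓ ^ k` the sign is `σ ^ (d / μ)`, modulo a divisor of `D₂` it is `(-σ) ^ (d / μ)`; they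
agree if and only if `d / μ` is even. -/
theorem dvd_pow_sub_iff_of_dvd_D₂ (S : SignData ℓ p μ v D₁ D₂ σ) {k m : ℕ} (hk : 2 < ℓ ^ k)
    (hm : (ℓ ^ k).Coprime m) (hm2 : 2 < m) (hmD : m ∣ D₂) (d : ℕ) :
    (((ℓ ^ k * m : ℕ) : ℤ) ∣ (p : ℤ) ^ d - 1 ∨ ((ℓ ^ k * m : ℕ) : ℤ) ∣ (p : ℤ) ^ d - (-1)) ↔
      μ * ℓ ^ (k - v) ∣ d ∧ 2 ∣ d / μ := by
  have hmD' : (m : ℤ) ∣ (p : ℤ) ^ μ - (-σ) := by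
    rw [sub_neg_eq_add, ← S.D₂_eq]
    exact_mod_cast hmD
  have hms : ∀ e, (m : ℤ) ∣ (p : ℤ) ^ (μ * e) - (-σ) ^ e := fun e => by
    rw [pow_mul]
    exact hmD'.trans (sub_dvd_pow_sub_pow _ _ e)
  have hσ' : -σ = 1 ∨ -σ = -1 := by rcases S.sign with h | h <;> simp [h]
  have hne : ∀ e : ℕ, (-σ) ^ e = σ ^ e ↔ 2 ∣ e := by
    intro e
    rw [← even_iff_two_dvd]
    rcases Nat.even_or_odd e with he | he
    · simp [he.neg_pow, he]
    · rw [he.neg_pow]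
      have := pow_eq_one_or_neg_one S.sign e
      simp only [Nat.not_even_iff_odd.2 he, iff_false]
      omega
  have key : ∀ s : ℤ, (s = 1 ∨ s = -1) →
      ((ℓ : ℤ) ^ k ∣ (p : ℤ) ^ d - s ∧ (m : ℤ) ∣ (p : ℤ) ^ d - s ↔
        (μ * ℓ ^ (k - v) ∣ d ∧ 2 ∣ d / μ) ∧ s = σ ^ (d / μ)) := by
    intro s hs
    rw [S.pow_dvd_iff k d s hk hs]
    constructor
    · rintro ⟨⟨h1, h2⟩, h3⟩
      refine ⟨⟨h1, ?_⟩, h2⟩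
      obtain ⟨e, rfl⟩ := (dvd_mul_right _ _).trans h1
      rw [Nat.mul_div_cancel_left _ S.μ_pos] at h2 ⊢
      rw [← hne, ← h2]
      exact sign_eq_of_dvd (by exact_mod_cast hm2) (pow_eq_one_or_neg_one hσ' e) hs (hms e) h3
    · rintro ⟨⟨h1, h2⟩, h3⟩
      refine ⟨⟨h1, h3⟩, ?_⟩
      rw [← hne] at h2
      rw [h3, ← h2]
      obtain ⟨e, rfl⟩ := (dvd_mul_right _ _).trans h1
      rw [Nat.mul_div_cancel_left _ S.μ_pos]
      exact hms e
  rw [cast_mul_dvd_iff hm, cast_mul_dvd_iff hm, key 1 (Or.inl rfl), key (-1) (Or.inr rfl),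
    ← and_or_left, and_iff_left]
  exact (pow_eq_one_or_neg_one S.sign (d / μ)).imp Eq.symm Eq.symm

end SignData

/-! ### Preperiods and orders -/

section Roots

variable {ℓ p : ℕ} [Fact p.Prime] {L : Type*} [Field L] [Algebra (ZMod p) L]

theorem natCast_pow_ne_zero (hℓ : ℓ.Prime) (hpℓ : p ≠ ℓ) (n : ℕ) : ((ℓ ^ n : ℕ) : L) ≠ 0 := by
  have : CharP L p := charP_of_injective_algebraMap (algebraMap (ZMod p) L).injective p
  have hp : p.Prime := Fact.out
  intro h
  rw [CharP.cast_eq_zero_iff L p] at h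
  exact hpℓ ((Nat.prime_dvd_prime_iff_eq hp hℓ).1 (hp.dvd_of_dvd_pow h))

theorem algebraMap_iterate_chebMap {a : ZMod p} {α : L} (hα : α ≠ 0)
    (ha : algebraMap (ZMod p) L a = α + α⁻¹) (k : ℕ) :
    algebraMap (ZMod p) L ((chebMap ℓ p)^[k] a) = α ^ ℓ ^ k + (α ^ ℓ ^ k)⁻¹ := by
  induction k with
  | zero => simpa using ha
  | succ k ih =>
    rw [Function.iterate_succ_apply', chebMap, chebT, Chebyshev.algebraMap_eval_C, ih,
      chebyshevC_eval_add (mul_inv_cancel₀ (pow_ne_zero _ hα)), inv_pow, ← pow_mul, ← pow_succ]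

theorem iterate_chebMap_eq_iff {a : ZMod p} {α : L} (hα : α ≠ 0)
    (ha : algebraMap (ZMod p) L a = α + α⁻¹) (i j : ℕ) :
    (chebMap ℓ p)^[i] a = (chebMap ℓ p)^[j] a ↔
      ((orderOf α : ℤ) ∣ (ℓ : ℤ) ^ i - (ℓ : ℤ) ^ j ∨
        (orderOf α : ℤ) ∣ (ℓ : ℤ) ^ i - (-(ℓ : ℤ) ^ j)) := by
  rw [← (algebraMap (ZMod p) L).injective.eq_iff, algebraMap_iterate_chebMap hα ha,
    algebraMap_iterate_chebMap hα ha, pow_add_inv_eq_iff hα]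
  push_cast
  rfl

/-- The orbit of `α + α⁻¹` becomes periodic as soon as raising to the `ℓ`-th power has removed the
`ℓ`-part of the order of `α`. -/
theorem preperiod_chebMap_eq (hℓ : ℓ.Prime) {a : ZMod p} {α : L} (hα : α ≠ 0)
    (ha : algebraMap (ZMod p) L a = α + α⁻¹) {r m : ℕ} (hm : ¬ ℓ ∣ m)
    (hord : orderOf α = ℓ ^ r * m) : preperiod (chebMap ℓ p) a = r := by
  have hm0 : 0 < m := by
    rw [Nat.pos_iff_ne_zero]
    rintro rfl
    simp at hm
  have hper : (chebMap ℓ p)^[r + m.totient] a = (chebMap ℓ p)^[r] a := by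
    rw [iterate_chebMap_eq_iff hα ha, hord]
    left
    rw [pow_add]
    push_cast
    rw [show (ℓ : ℤ) ^ r * (ℓ : ℤ) ^ m.totient - (ℓ : ℤ) ^ r =
      (ℓ : ℤ) ^ r * ((ℓ : ℤ) ^ m.totient - 1) by ring]
    refine mul_dvd_mul_left _ ?_
    have := Nat.modEq_iff_dvd.1 (Nat.ModEq.pow_totient ((hℓ.coprime_iff_not_dvd).2 hm)).symm
    push_cast at this
    exact this
  refine le_antisymm (Nat.sInf_le ⟨m.totient, Nat.totient_pos.2 hm0, hper⟩)
    (le_csInf ⟨r, m.totient, Nat.totient_pos.2 hm0, hper⟩ ?_)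
  rintro r' ⟨k, hk, h⟩
  have hℓ1 := hℓ.one_lt
  have aux : ∀ s : ℤ, (s = 1 ∨ s = -1) →
      ((ℓ ^ r * m : ℕ) : ℤ) ∣ (ℓ : ℤ) ^ (r' + k) - s * (ℓ : ℤ) ^ r' → r ≤ r' := by
    intro s hs h
    have h1 : (ℓ : ℤ) ^ r ∣ (ℓ : ℤ) ^ r' * ((ℓ : ℤ) ^ k - s) := by
      refine Dvd.dvd.trans ⟨(m : ℤ), by push_cast; ring⟩ (h.trans (dvd_of_eq ?_))
      ring
    have h2 : IsCoprime ((ℓ : ℤ) ^ r) ((ℓ : ℤ) ^ k - s) := by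
      refine IsCoprime.pow_left ?_
      obtain ⟨k, rfl⟩ := Nat.exists_eq_add_of_le hk
      refine ⟨s * (ℓ : ℤ) ^ k, -s, ?_⟩
      have : s * s = 1 := by rcases hs with rfl | rfl <;> rfl
      linear_combination this
    have h3 := h2.dvd_of_dvd_mul_right h1
    have h4 : ℓ ^ r ∣ ℓ ^ r' := by exact_mod_cast h3
    exact (Nat.pow_dvd_pow_iff_le_right hℓ1).1 h4
  rw [iterate_chebMap_eq_iff hα ha, hord] at h
  rcases h with h | h
  · exact aux 1 (Or.inl rfl) (by rwa [one_mul])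
  · exact aux (-1) (Or.inr rfl) (by rwa [neg_one_mul])

theorem card_primitiveRoots_pow [IsAlgClosed L] (hℓ : ℓ.Prime) (hpℓ : p ≠ ℓ) (k : ℕ) :
    (primitiveRoots (ℓ ^ k) L).card = (ℓ ^ k).totient := by
  have : NeZero ((ℓ ^ k : ℕ) : L) := ⟨natCast_pow_ne_zero (p := p) hℓ hpℓ k⟩
  obtain ⟨ζ, hζ⟩ := HasEnoughRootsOfUnity.exists_primitiveRoot L (ℓ ^ k)
  exact hζ.card_primitiveRoots

variable [Algebra.IsAlgebraic (ZMod p) L]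

theorem natDegree_minpoly_add_inv_eq {b : L} (hb : b ≠ 0) {D : ℕ}
    (h : ∀ d : ℕ, ((orderOf b : ℤ) ∣ (p : ℤ) ^ d - 1 ∨ (orderOf b : ℤ) ∣ (p : ℤ) ^ d - (-1)) ↔
      D ∣ d) :
    (minpoly (ZMod p) (b + b⁻¹)).natDegree = D := by
  refine Nat.dvd_antisymm ?_ ?_
  · rw [natDegree_minpoly_add_inv_dvd_iff hb, h]
  · rw [← h, ← natDegree_minpoly_add_inv_dvd_iff hb]

theorem natDegree_minpoly_add_inv_eq_one_iff {b : L} (hb : b ≠ 0) :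
    (minpoly (ZMod p) (b + b⁻¹)).natDegree = 1 ↔
      ((orderOf b : ℤ) ∣ (p : ℤ) - 1 ∨ (orderOf b : ℤ) ∣ (p : ℤ) - (-1)) := by
  rw [← Nat.dvd_one, natDegree_minpoly_add_inv_dvd_iff hb, pow_one]

theorem mem_range_iff_orderOf_dvd {b : L} (hb : b ≠ 0) :
    b + b⁻¹ ∈ (algebraMap (ZMod p) L).range ↔
      ((orderOf b : ℤ) ∣ (p : ℤ) - 1 ∨ (orderOf b : ℤ) ∣ (p : ℤ) - (-1)) := by
  rw [← natDegree_minpoly_add_inv_eq_one_iff hb, minpoly.natDegree_eq_one_iff]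

theorem orderOf_pos_of_algebraMap_eq {a : ZMod p} {α : L} (hα : α ≠ 0)
    (ha : algebraMap (ZMod p) L a = α + α⁻¹) : 0 < orderOf α := by
  have hp := (Fact.out : p.Prime).two_le
  have h := (mem_range_iff_orderOf_dvd (p := p) hα).1 ⟨a, ha⟩
  rw [Nat.pos_iff_ne_zero]
  intro h0
  rw [h0, Nat.cast_zero, zero_dvd_iff, zero_dvd_iff] at h
  omega

end Roots

theorem orderOf_eq_of_orderOf_pow_prime_pow {G : Type*} [Monoid G] {ℓ : ℕ} (hℓ : ℓ.Prime)
    {b : G} {n : ℕ} (h : ℓ ∣ orderOf (b ^ ℓ ^ n)) :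
    orderOf b = ℓ ^ n * orderOf (b ^ ℓ ^ n) := by
  induction n with
  | zero => simp
  | succ n ih =>
    have key : orderOf (b ^ ℓ ^ n) = ℓ * orderOf (b ^ ℓ ^ (n + 1)) := by
      rw [pow_succ, pow_mul] at h ⊢
      set c := b ^ ℓ ^ n
      rw [orderOf_pow' c hℓ.ne_zero] at h ⊢
      rcases (Nat.dvd_prime hℓ).1 (Nat.gcd_dvd_right (orderOf c) ℓ) with h1 | h1
      · rw [h1, Nat.div_one] at h
        rw [Nat.gcd_eq_right h] at h1
        exact absurd h1 hℓ.ne_one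
      · rw [h1]
        rw [Nat.mul_div_cancel']
        exact h1 ▸ Nat.gcd_dvd_left (orderOf c) ℓ
    rw [ih (key ▸ dvd_mul_right _ _), key, pow_succ, mul_assoc]

theorem factorization_pow_mul {ℓ k m : ℕ} (hℓ : ℓ.Prime) (hm : ¬ ℓ ∣ m) :
    (ℓ ^ k * m).factorization ℓ = k := by
  have hm0 : m ≠ 0 := by rintro rfl; simp at hm
  rw [Nat.factorization_mul (pow_ne_zero _ hℓ.ne_zero) hm0, Finsupp.add_apply,
    hℓ.factorization_pow, Finsupp.single_eq_same, Nat.factorization_eq_zero_of_not_dvd hm,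
    add_zero]

section Field

variable {L : Type*} [Field L]

theorem exists_root_orderOf_eq {α : L} {N : ℕ} (h : N.Coprime (orderOf α)) :
    ∃ β : L, β ^ N = α ∧ orderOf β = orderOf α := by
  obtain ⟨e, he⟩ := exists_pow_eq_self_of_coprime h
  have h1 : (α ^ e) ^ N = α := by rw [← pow_mul, mul_comm, pow_mul, he]
  refine ⟨α ^ e, h1, Nat.dvd_antisymm (orderOf_pow_dvd e) ?_⟩
  nth_rw 1 [← h1]
  exact orderOf_pow_dvd N

theorem orderOf_mul_of_orderOf_eq_prime_pow {β ζ : L} {k : ℕ} (hℓ : ℓ.Prime) (hm : ¬ ℓ ∣ orderOf β)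
    (hζ : orderOf ζ = ℓ ^ k) : orderOf (ζ * β) = ℓ ^ k * orderOf β := by
  rw [(Commute.all ζ β).orderOf_mul_eq_mul_orderOf_of_coprime, hζ]
  rw [hζ]
  exact Nat.Coprime.pow_left k ((hℓ.coprime_iff_not_dvd).2 hm)

theorem exists_orderOf_eq_of_mem_nthRootsFinset {α b : L} {n : ℕ} (hℓ : ℓ.Prime) (hα : α ≠ 0)
    (hm : ¬ ℓ ∣ orderOf α) (hb : b ∈ nthRootsFinset (ℓ ^ n) α) :
    ∃ k ≤ n, orderOf b = ℓ ^ k * orderOf α := by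
  obtain ⟨β, hβ, hβo⟩ := exists_root_orderOf_eq
    (Nat.Coprime.pow_left n ((hℓ.coprime_iff_not_dvd).2 hm))
  have hN : 0 < ℓ ^ n := pow_pos hℓ.pos n
  have hβ0 : β ≠ 0 := by
    rintro rfl
    rw [zero_pow hN.ne'] at hβ
    exact hα hβ.symm
  rw [mem_nthRootsFinset hN] at hb
  have h1 : (b / β) ^ ℓ ^ n = 1 := by rw [div_pow, hb, hβ, div_self hα]
  obtain ⟨k, hk, ho⟩ := (Nat.dvd_prime_pow hℓ).1 (orderOf_dvd_of_pow_eq_one h1)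
  refine ⟨k, hk, ?_⟩
  rw [← hβo, ← orderOf_mul_of_orderOf_eq_prime_pow hℓ (hβo ▸ hm) ho, div_mul_cancel₀ _ hβ0]

end Field

section Count

variable {ℓ p : ℕ} [Fact p.Prime] {L : Type*} [Field L] [Algebra (ZMod p) L]

theorem card_filter_orderOf_eq [IsAlgClosed L] {α : L} {n k : ℕ} (hℓ : ℓ.Prime) (hpℓ : p ≠ ℓ)
    (hα : α ≠ 0) (hm : ¬ ℓ ∣ orderOf α) (hk : k ≤ n) :
    ((nthRootsFinset (ℓ ^ n) α).filter fun b => (orderOf b).factorization ℓ = k).card =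
      (ℓ ^ k).totient := by
  obtain ⟨β, hβ, hβo⟩ := exists_root_orderOf_eq
    (Nat.Coprime.pow_left n ((hℓ.coprime_iff_not_dvd).2 hm))
  have hN : 0 < ℓ ^ n := pow_pos hℓ.pos n
  have hβ0 : β ≠ 0 := by
    rintro rfl
    rw [zero_pow hN.ne'] at hβ
    exact hα hβ.symm
  rw [← card_primitiveRoots_pow (p := p) (L := L) hℓ hpℓ k]
  symm
  refine Finset.card_bij' (fun ζ _ => ζ * β) (fun b _ => b / β) ?_ ?_ ?_ ?_
  · intro ζ hζ
    rw [mem_primitiveRoots (pow_pos hℓ.pos k)] at hζ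
    rw [Finset.mem_filter, mem_nthRootsFinset hN, orderOf_mul_of_orderOf_eq_prime_pow hℓ (hβo ▸ hm)
      hζ.eq_orderOf.symm, factorization_pow_mul hℓ (hβo ▸ hm), mul_pow, hβ]
    refine ⟨?_, rfl⟩
    rw [(hζ.pow_eq_one_iff_dvd _).2 (pow_dvd_pow ℓ hk), one_mul]
  · intro b hb
    rw [Finset.mem_filter] at hb
    rw [mem_primitiveRoots (pow_pos hℓ.pos k), IsPrimitiveRoot.iff_orderOf]
    have hb1 := (mem_nthRootsFinset hN α).1 hb.1
    have h1 : (b / β) ^ ℓ ^ n = 1 := by rw [div_pow, hb1, hβ, div_self hα]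
    obtain ⟨j, hj, ho⟩ := (Nat.dvd_prime_pow hℓ).1 (orderOf_dvd_of_pow_eq_one h1)
    have h2 := orderOf_mul_of_orderOf_eq_prime_pow hℓ (hβo ▸ hm) ho
    rw [div_mul_cancel₀ _ hβ0] at h2
    rw [h2, factorization_pow_mul hℓ (hβo ▸ hm)] at hb
    rw [ho, hb.2]
  · intro ζ _
    exact mul_div_cancel_right₀ ζ hβ0
  · intro b _
    exact div_mul_cancel₀ b hβ0

end Count

section Classes

variable {ℓ p : ℕ} [Fact p.Prime] {L : Type*} [Field L] [DecidableEq L] [IsAlgClosed L]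
  [Algebra (ZMod p) L]

/-- For periodic `α + α⁻¹` the `ℓ ^ n`-th roots of `α` are classified by the `ℓ`-part `ℓ ^ k` of
their order; the class of `k` is a translate of the primitive `ℓ ^ k`-th roots of unity. -/
theorem factType_of_not_dvd_orderOf (hℓ : ℓ.Prime) (hpℓ : p ≠ ℓ) {a : ZMod p} {α : L} (hα : α ≠ 0)
    (ha : algebraMap (ZMod p) L a = α + α⁻¹) (hm : ¬ ℓ ∣ orderOf α) (n : ℕ) (d e c : ℕ → ℕ)
    (hpos : ∀ k ≤ n, 0 < d k ∧ 0 < e k)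
    (hd : ∀ k ≤ n, ∀ b : L, b ≠ 0 → orderOf b = ℓ ^ k * orderOf α →
      (minpoly (ZMod p) (b + b⁻¹)).natDegree = d k)
    (he : ∀ k ≤ n, ∀ b ∈ nthRootsFinset (ℓ ^ n) α, orderOf b = ℓ ^ k * orderOf α →
      ((nthRootsFinset (ℓ ^ n) α).filter fun b' => b' + b'⁻¹ = b + b⁻¹).card = e k)
    (hc : ∀ k ≤ n, (ℓ ^ k).totient = d k * e k * c k) :
    factType (Chebyshev.C (ZMod p) ((ℓ ^ n : ℕ) : ℤ) - C a) =
      ∑ k ∈ Finset.range (n + 1), Multiset.replicate (c k) (d k, e k) := by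
  have hN : ((ℓ ^ n : ℕ) : L) ≠ 0 := natCast_pow_ne_zero (p := p) hℓ hpℓ n
  have hcls : ∀ b ∈ nthRootsFinset (ℓ ^ n) α, (orderOf b).factorization ℓ ≤ n ∧
      orderOf b = ℓ ^ (orderOf b).factorization ℓ * orderOf α := by
    intro b hb
    obtain ⟨k, hk, ho⟩ := exists_orderOf_eq_of_mem_nthRootsFinset hℓ hα hm hb
    have : (orderOf b).factorization ℓ = k := by rw [ho, factorization_pow_mul hℓ hm]
    rw [this]
    exact ⟨hk, ho⟩
  refine factType_eq_sum_replicate (monic_chebyshevC_sub_C hN hα ha)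
    (aroots_chebyshevC_sub_C hN hα ha) (cls := fun b => (orderOf b).factorization ℓ) ?_ d e c ?_
    ?_ ?_ ?_
  · intro b hb
    exact Finset.mem_range.2 (Nat.lt_succ_of_le (hcls b hb).1)
  · intro k hk
    exact hpos k (Nat.lt_succ_iff.1 (Finset.mem_range.1 hk))
  · intro b hb
    exact hd _ (hcls b hb).1 b (ne_zero_of_mem_nthRootsFinset hα hb) (hcls b hb).2
  · intro b hb
    exact he _ (hcls b hb).1 b hb (hcls b hb).2
  · intro k hk
    have hk' := Nat.lt_succ_iff.1 (Finset.mem_range.1 hk)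
    rw [card_filter_orderOf_eq (p := p) hℓ hpℓ hα hm hk', hc k hk']

/-- For strictly preperiodic `α + α⁻¹` all `ℓ ^ n`-th roots of `α` have the same order. -/
theorem factType_of_dvd_orderOf (hℓ : ℓ.Prime) (hpℓ : p ≠ ℓ) {a : ZMod p} {α : L} (hα : α ≠ 0)
    (ha : algebraMap (ZMod p) L a = α + α⁻¹) (hm : ℓ ∣ orderOf α) (n : ℕ) {d e c : ℕ}
    (hpos : 0 < d ∧ 0 < e)
    (hd : ∀ b : L, b ≠ 0 → orderOf b = ℓ ^ n * orderOf α →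
      (minpoly (ZMod p) (b + b⁻¹)).natDegree = d)
    (he : ∀ b ∈ nthRootsFinset (ℓ ^ n) α, orderOf b = ℓ ^ n * orderOf α →
      ((nthRootsFinset (ℓ ^ n) α).filter fun b' => b' + b'⁻¹ = b + b⁻¹).card = e)
    (hc : ℓ ^ n = d * e * c) :
    factType (Chebyshev.C (ZMod p) ((ℓ ^ n : ℕ) : ℤ) - C a) = Multiset.replicate c (d, e) := by
  have hN : ((ℓ ^ n : ℕ) : L) ≠ 0 := natCast_pow_ne_zero (p := p) hℓ hpℓ n
  have ho : ∀ b ∈ nthRootsFinset (ℓ ^ n) α, orderOf b = ℓ ^ n * orderOf α := by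
    intro b hb
    rw [mem_nthRootsFinset (pow_pos hℓ.pos n)] at hb
    rw [← hb] at hm ⊢
    exact orderOf_eq_of_orderOf_pow_prime_pow hℓ hm
  have := factType_eq_sum_replicate (monic_chebyshevC_sub_C hN hα ha)
    (aroots_chebyshevC_sub_C hN hα ha) (I := {()}) (cls := fun _ => ()) (by simp)
    (fun _ => d) (fun _ => e) (fun _ => c) (fun _ _ => hpos)
    (fun b hb => hd b (ne_zero_of_mem_nthRootsFinset hα hb) (ho b hb))
    (fun b hb => he b hb (ho b hb))
    (by simpa [card_nthRootsFinset_eq hN hα] using hc)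
  rw [this, Finset.sum_singleton]

end Classes

/-! ### Degrees over `𝔽_p` by order -/

theorem sum_replicate {ι α : Type*} (s : Finset ι) (c : ι → ℕ) (x : α) :
    ∑ i ∈ s, Multiset.replicate (c i) x = Multiset.replicate (∑ i ∈ s, c i) x := by
  classical
  induction s using Finset.induction_on with
  | empty => simp
  | insert i s hi ih => rw [Finset.sum_insert hi, Finset.sum_insert hi, ih, Multiset.replicate_add]

theorem sum_range_eq_add_sum_Icc {M : Type*} [AddCommMonoid M] (h : ℕ → M) (n v : ℕ) :
    ∑ k ∈ Finset.range n, h k =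
      ∑ k ∈ Finset.range (min n v), h k + ∑ k ∈ Finset.Icc 1 (n - v), h (v + k - 1) := by
  rcases le_total n v with hnv | hnv
  · rw [min_eq_left hnv, Nat.sub_eq_zero_of_le hnv]
    simp
  · rw [min_eq_right hnv]
    obtain ⟨j, rfl⟩ := Nat.exists_eq_add_of_le hnv
    rw [Finset.sum_range_add, Nat.add_sub_cancel_left]
    congr 1
    refine Finset.sum_bij' (fun k _ => k + 1) (fun k _ => k - 1) ?_ ?_ ?_ ?_ ?_ <;>
      intro k hk <;> simp only [Finset.mem_range, Finset.mem_Icc] at hk ⊢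
    · omega
    · omega
    · omega
    · omega
    · rw [← add_assoc, Nat.add_sub_cancel]

namespace SignData

variable {ℓ p μ v D₁ D₂ : ℕ} {σ : ℤ}

theorem pow_dvd_D₁ (S : SignData ℓ p μ v D₁ D₂ σ) : ℓ ^ v ∣ D₁ := by
  have := (S.pow_dvd_iff v μ σ S.two_lt S.sign).2
    ⟨by simp, by rw [Nat.div_self S.μ_pos, pow_one]⟩
  rw [← S.D₁_eq] at this
  exact_mod_cast this

theorem two_le_v (S : SignData 2 p μ v D₁ D₂ σ) : 2 ≤ v := by
  by_contra hlt
  have h1 : 2 ^ v ≤ 2 ^ 1 := Nat.pow_le_pow_right two_pos (by omega)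
  have := S.two_lt
  omega

theorem le_two_of_dvd (S : SignData ℓ p μ v D₁ D₂ σ) {m : ℕ} (h₁ : m ∣ D₁) (h₂ : m ∣ D₂) :
    m ≤ 2 := by
  have h1 : (m : ℤ) ∣ D₁ := by exact_mod_cast h₁
  have h2 : (m : ℤ) ∣ D₂ := by exact_mod_cast h₂
  have h := dvd_sub h2 h1
  rw [S.D₁_eq, S.D₂_eq] at h
  have h3 : (m : ℤ) ∣ 2 := by
    rcases S.sign with rfl | rfl
    · exact h.trans (by ring_nf; rfl)
    · exact (dvd_neg.2 h).trans (by ring_nf; rfl)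
  exact_mod_cast Int.le_of_dvd (by norm_num) h3

theorem two_dvd_D₁ (S : SignData ℓ p μ v D₁ D₂ σ) (hp : ¬ 2 ∣ p) : 2 ∣ D₁ := by
  have h : Odd ((p : ℤ) ^ μ) := by
    refine Odd.pow ?_
    rw [Int.odd_coe_nat, ← Nat.not_even_iff_odd, even_iff_two_dvd]
    exact hp
  have h' : Even (D₁ : ℤ) := by
    rw [S.D₁_eq]
    rcases S.sign with rfl | rfl
    · exact h.sub_odd odd_one
    · exact h.sub_odd odd_one.neg
  rw [← even_iff_two_dvd]
  exact_mod_cast h'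

/-- An element of `𝔽_p` with preperiod `r` comes from an `α` of order `ℓ ^ r * m` dividing `p - 1`
or `p + 1`; unless `ℓ ^ r ≤ 2`, this forces `μ = 1` and singles out `D₁`. -/
theorem of_pow_mul_dvd (S : SignData ℓ p μ v D₁ D₂ σ) (hℓ : ℓ.Prime) {r m : ℕ} (hr : 2 < ℓ ^ r)
    (h : ((ℓ ^ r * m : ℕ) : ℤ) ∣ (p : ℤ) - 1 ∨ ((ℓ ^ r * m : ℕ) : ℤ) ∣ (p : ℤ) - (-1)) :
    μ = 1 ∧ r ≤ v ∧ ℓ ^ r * m ∣ D₁ := by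
  obtain ⟨τ, hτ, h⟩ : ∃ τ : ℤ, (τ = 1 ∨ τ = -1) ∧ ((ℓ ^ r * m : ℕ) : ℤ) ∣ (p : ℤ) - τ := by
    rcases h with h | h
    · exact ⟨1, Or.inl rfl, h⟩
    · exact ⟨-1, Or.inr rfl, h⟩
  have h1 : (ℓ : ℤ) ^ r ∣ (p : ℤ) ^ 1 - τ := by
    rw [pow_one]
    refine Dvd.dvd.trans ?_ h
    push_cast
    exact dvd_mul_right _ _
  obtain ⟨h2, h3⟩ := (S.pow_dvd_iff r 1 τ hr hτ).1 h1
  rw [Nat.dvd_one, mul_eq_one] at h2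
  obtain ⟨rfl, h2⟩ := h2
  refine ⟨rfl, ?_, ?_⟩
  · by_contra hlt
    have : 1 < ℓ ^ (r - v) := Nat.one_lt_pow (by omega) hℓ.one_lt
    omega
  · rw [Nat.div_self one_pos, pow_one] at h3
    have h4 := S.D₁_eq
    rw [pow_one, ← h3] at h4
    rw [← h4] at h
    exact_mod_cast h

end SignData

theorem eq_two_of_pow_le_two (hℓ : ℓ.Prime) {k : ℕ} (hk : 0 < k) (h : ℓ ^ k ≤ 2) :
    ℓ = 2 ∧ k = 1 := by
  have h1 := Nat.le_self_pow hk.ne' ℓ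
  have h2 := hℓ.two_le
  obtain rfl : ℓ = 2 := by omega
  refine ⟨rfl, le_antisymm ?_ hk⟩
  by_contra hlt
  have := Nat.pow_le_pow_right (n := 2) two_pos (by omega : 2 ≤ k)
  omega

section SignElements

variable {ℓ p μ v D₁ D₂ : ℕ} {σ : ℤ} [Fact p.Prime] {L : Type*} [Field L] [Algebra (ZMod p) L]

theorem eq_one_iff_of_algebraMap_eq {a : ZMod p} {α : L} (hα : α ≠ 0)
    (ha : algebraMap (ZMod p) L a = α + α⁻¹) : α = 1 ↔ a = 2 := by
  rw [← (algebraMap (ZMod p) L).injective.eq_iff, ha, map_ofNat,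
    show (2 : L) = 1 + 1⁻¹ by norm_num, add_inv_eq_add_inv_iff hα one_ne_zero, inv_one, or_self]

theorem eq_neg_one_iff_of_algebraMap_eq {a : ZMod p} {α : L} (hα : α ≠ 0)
    (ha : algebraMap (ZMod p) L a = α + α⁻¹) : α = -1 ↔ a = -2 := by
  rw [← (algebraMap (ZMod p) L).injective.eq_iff, ha, map_neg, map_ofNat,
    show (-2 : L) = -1 + (-1)⁻¹ by norm_num,
    add_inv_eq_add_inv_iff hα (neg_ne_zero.2 one_ne_zero), inv_neg, inv_one, or_self]

theorem orderOf_dvd_D₁_of_sq_eq_one (S : SignData ℓ p μ v D₁ D₂ σ) {α : L} (h : α ^ 2 = 1) :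
    orderOf α ∣ D₁ := by
  have hL : CharP L p := charP_of_injective_algebraMap (algebraMap (ZMod p) L).injective p
  by_cases hp : 2 ∣ p
  · obtain rfl := (Nat.prime_dvd_prime_iff_eq Nat.prime_two Fact.out).1 hp
    have : α = 1 := by
      rcases sq_eq_one_iff.1 h with h | h
      · exact h
      · rw [h, CharTwo.neg_eq]
    rw [this, orderOf_one]
    exact one_dvd _
  · exact (orderOf_dvd_of_pow_eq_one h).trans (S.two_dvd_D₁ hp)

theorem two_lt_orderOf {α : L} (h0 : 0 < orderOf α) (h : α ^ 2 ≠ 1) : 2 < orderOf α := by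
  by_contra hlt
  refine h (orderOf_dvd_iff_pow_eq_one.1 ?_)
  rcases (by omega : orderOf α = 1 ∨ orderOf α = 2) with h1 | h1 <;> rw [h1]
  exact one_dvd 2

theorem sq_eq_one_iff_of_algebraMap_eq {a : ZMod p} {α : L} (hα : α ≠ 0)
    (ha : algebraMap (ZMod p) L a = α + α⁻¹) : α ^ 2 = 1 ↔ a = 2 ∨ a = -2 := by
  rw [sq_eq_one_iff, eq_one_iff_of_algebraMap_eq hα ha,
    eq_neg_one_iff_of_algebraMap_eq hα ha]

end SignElements

section Cases

variable {ℓ p μ v D₁ D₂ : ℕ} {σ : ℤ} [Fact p.Prime] {L : Type*} [Field L]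
  [Algebra (ZMod p) L] [Algebra.IsAlgebraic (ZMod p) L]

theorem natDegree_minpoly_of_dvd_D₁ (S : SignData ℓ p μ v D₁ D₂ σ) (hℓ : ℓ.Prime) (hpℓ : p ≠ ℓ)
    {k m : ℕ} (hk : 0 < k) (hm : ¬ ℓ ∣ m) (hmD : m ∣ D₁) {b : L} (hb : b ≠ 0)
    (ho : orderOf b = ℓ ^ k * m) :
    (minpoly (ZMod p) (b + b⁻¹)).natDegree = μ * ℓ ^ (k - v) := by
  have hcop : (ℓ ^ k).Coprime m := Nat.Coprime.pow_left k ((hℓ.coprime_iff_not_dvd).2 hm)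
  rcases lt_or_ge 2 (ℓ ^ k) with h | h
  · refine natDegree_minpoly_add_inv_eq hb fun d => ?_
    rw [ho]
    exact S.dvd_pow_sub_iff_of_dvd_D₁ h hcop hmD d
  · obtain ⟨rfl, rfl⟩ := eq_two_of_pow_le_two hℓ hk h
    have hv := S.v_pos
    rw [Nat.sub_eq_zero_of_le hv, pow_zero, mul_one, S.μ_eq_one rfl,
      natDegree_minpoly_add_inv_eq_one_iff hb, ho]
    have hp2 : ¬ 2 ∣ p := fun h2 =>
      hpℓ ((Nat.prime_dvd_prime_iff_eq hℓ Fact.out).1 h2).symm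
    have h1 : ((2 ^ 1 * m : ℕ) : ℤ) ∣ (D₁ : ℤ) := by
      refine Int.natCast_dvd_natCast.2 ?_
      exact hcop.mul_dvd_of_dvd_of_dvd (by simpa using S.two_dvd_D₁ hp2) hmD
    rw [S.D₁_eq, S.μ_eq_one rfl, pow_one (p : ℤ)] at h1
    rcases S.sign with rfl | rfl
    · exact Or.inl h1
    · exact Or.inr h1

theorem natDegree_minpoly_of_dvd_D₂ (S : SignData ℓ p μ v D₁ D₂ σ) (hℓ : ℓ.Prime)
    {k m : ℕ} (hk : 2 < ℓ ^ k) (hm : ¬ ℓ ∣ m) (hm2 : 2 < m) (hmD : m ∣ D₂) {b : L} (hb : b ≠ 0)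
    (ho : orderOf b = ℓ ^ k * m) :
    (minpoly (ZMod p) (b + b⁻¹)).natDegree =
      if ℓ = 2 then 2 ^ max 1 (k - v) else 2 * μ * ℓ ^ (k - v) := by
  have hcop : (ℓ ^ k).Coprime m := Nat.Coprime.pow_left k ((hℓ.coprime_iff_not_dvd).2 hm)
  refine natDegree_minpoly_add_inv_eq hb fun d => ?_
  rw [ho, S.dvd_pow_sub_iff_of_dvd_D₂ hk hcop hm2 hmD d]
  split_ifs with h
  · subst h
    rw [S.μ_eq_one rfl, one_mul, Nat.div_one]
    constructor
    · rintro ⟨h1, h2⟩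
      rcases le_total 1 (k - v) with h3 | h3
      · rwa [max_eq_right h3]
      · rwa [max_eq_left h3, pow_one]
    · intro h1
      exact ⟨(pow_dvd_pow 2 (le_max_right _ _)).trans h1,
        (dvd_pow_self 2 (by omega)).trans h1⟩
  · have hodd : Nat.Coprime 2 (ℓ ^ (k - v)) :=
      Nat.Coprime.pow_right _ ((Nat.coprime_primes Nat.prime_two hℓ).2 (Ne.symm h))
    rw [show 2 * μ * ℓ ^ (k - v) = μ * (2 * ℓ ^ (k - v)) by ring]
    constructor
    · rintro ⟨h1, h2⟩
      obtain ⟨e, rfl⟩ := (dvd_mul_right _ _).trans h1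
      rw [Nat.mul_div_cancel_left _ S.μ_pos] at h2
      exact Nat.mul_dvd_mul_left μ
        (hodd.mul_dvd_of_dvd_of_dvd h2 (Nat.dvd_of_mul_dvd_mul_left S.μ_pos h1))
    · intro h1
      refine ⟨(Nat.mul_dvd_mul_left μ (dvd_mul_left _ _)).trans h1, ?_⟩
      obtain ⟨e, rfl⟩ := (dvd_mul_right _ _).trans h1
      rw [Nat.mul_div_cancel_left _ S.μ_pos]
      exact (dvd_mul_right _ _).trans (Nat.dvd_of_mul_dvd_mul_left S.μ_pos h1)

theorem exists_add_inv_orderOf_eq (L : Type*) [Field L] [IsAlgClosed L]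
    [Algebra (ZMod p) L] [Algebra.IsAlgebraic (ZMod p) L] (hℓ : ℓ.Prime) (a : ZMod p) :
    ∃ (α : L) (m : ℕ), α ≠ 0 ∧ algebraMap (ZMod p) L a = α + α⁻¹ ∧ ¬ ℓ ∣ m ∧
      orderOf α = ℓ ^ preperiod (chebMap ℓ p) a * m := by
  obtain ⟨α, hα, h⟩ := exists_add_inv_eq (algebraMap (ZMod p) L a)
  have hpos := orderOf_pos_of_algebraMap_eq hα h.symm
  obtain ⟨r, m, hm, ho⟩ := Nat.exists_eq_pow_mul_and_not_dvd hpos.ne' ℓ hℓ.ne_one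
  exact ⟨α, m, hα, h.symm, hm, by rw [preperiod_chebMap_eq hℓ hα h.symm hm ho, ho]⟩

theorem orderOf_algebraMap_dvd {a : ZMod p} {α : L} (hα : α ≠ 0)
    (ha : algebraMap (ZMod p) L a = α + α⁻¹) :
    (orderOf α : ℤ) ∣ (p : ℤ) - 1 ∨ (orderOf α : ℤ) ∣ (p : ℤ) - (-1) :=
  (mem_range_iff_orderOf_dvd hα).1 ⟨a, ha⟩

/-- The order of an `α` belonging to the entry point of the cycle does not depend on the choice
between `α` and `α⁻¹`: it is the prime-to-`ℓ` part of the order of any `α` with `a = α + α⁻¹`. -/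
theorem CycleDivides.dvd (hℓ : ℓ.Prime) {a : ZMod p} {D m : ℕ}
    (h : CycleDivides ℓ p a D) {α : AlgebraicClosure (ZMod p)} (hα : α ≠ 0)
    (ha : algebraMap (ZMod p) (AlgebraicClosure (ZMod p)) a = α + α⁻¹)
    (ho : orderOf α = ℓ ^ preperiod (chebMap ℓ p) a * m) : m ∣ D := by
  obtain ⟨γ, h1, h2⟩ := h
  rw [algebraMap_iterate_chebMap hα ha, Units.val_inv_eq_inv_val,
    add_inv_eq_add_inv_iff γ.ne_zero (pow_ne_zero _ hα)] at h1
  have h3 : orderOf (α ^ ℓ ^ preperiod (chebMap ℓ p) a) = m := by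
    rw [orderOf_pow_of_dvd (pow_ne_zero _ hℓ.ne_zero) (ho ▸ dvd_mul_right _ _), ho,
      Nat.mul_div_cancel_left _ (pow_pos hℓ.pos _)]
  have h4 : orderOf (γ : AlgebraicClosure (ZMod p)) = m := by
    rcases h1 with h1 | h1
    · rw [h1, h3]
    · have h5 : orderOf (γ⁻¹ : (AlgebraicClosure (ZMod p))ˣ) = m := by
        rw [← orderOf_units, Units.val_inv_eq_inv_val, h1, inv_inv, h3]
      rw [orderOf_units, ← orderOf_inv, h5]
  rw [← h4, orderOf_units]
  exact h2

end Cases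

/-! ### Factorization types by kind of cycle -/

section Types

variable {ℓ p μ v D₁ D₂ : ℕ} {σ : ℤ} [Fact p.Prime] {L : Type*} [Field L] [IsAlgClosed L]
  [Algebra (ZMod p) L] [Algebra.IsAlgebraic (ZMod p) L]

/-- Strictly preperiodic `a`, with cycle attached to `D₁`; the multiplicity `e` is `2` only for
`a = -2` and `ℓ = 2`. -/
theorem factType_of_strict_D₁ (S : SignData ℓ p μ v D₁ D₂ σ) (hℓ : ℓ.Prime) (hpℓ : p ≠ ℓ)
    {a : ZMod p} {α : L} (hα : α ≠ 0) (ha : algebraMap (ZMod p) L a = α + α⁻¹) {r m : ℕ}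
    (hr : 0 < r) (hm : ¬ ℓ ∣ m) (ho : orderOf α = ℓ ^ r * m) (hμ : μ = 1) (hmD : m ∣ D₁)
    {n : ℕ} (hn : 0 < n) {e c : ℕ} (he : α ^ 2 ≠ 1 ∧ e = 1 ∨ α ^ 2 = 1 ∧ e = 2)
    (hc : ℓ ^ n = ℓ ^ (n + r - v) * e * c) :
    factType (Chebyshev.C (ZMod p) ((ℓ ^ n : ℕ) : ℤ) - C a) =
      Multiset.replicate c (ℓ ^ (n + r - v), e) := by
  classical
  have hN : 0 < ℓ ^ n := pow_pos hℓ.pos n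
  have hdvd : ℓ ∣ orderOf α := ho ▸ (dvd_pow_self ℓ hr.ne').mul_right m
  refine factType_of_dvd_orderOf hℓ hpℓ hα ha hdvd n ⟨pow_pos hℓ.pos _, by omega⟩ ?_ ?_ hc
  · intro b hb hob
    rw [ho, ← mul_assoc, ← pow_add] at hob
    rw [natDegree_minpoly_of_dvd_D₁ S hℓ hpℓ (by omega) hm hmD hb hob, hμ, one_mul]
  · intro b hb hob
    rcases he with ⟨h2, rfl⟩ | ⟨h2, rfl⟩
    · exact card_fiber_eq_one hN hα h2 hb
    · rw [card_fiber_eq_ite hN hα h2 hb, if_neg]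
      intro h3
      have h4 : ℓ ^ 2 ∣ 2 := by
        refine Dvd.dvd.trans ?_ (orderOf_dvd_of_pow_eq_one h3)
        rw [hob, sq]
        exact mul_dvd_mul (dvd_pow_self ℓ hn.ne') hdvd
      have := Nat.le_of_dvd two_pos h4
      have := hℓ.two_le
      nlinarith

/-- For `ℓ = 2`, an `a` of preperiod `1` whose cycle is attached to `D₂`. -/
theorem factType_of_strict_D₂ (S : SignData 2 p μ v D₁ D₂ σ) (hp2 : p ≠ 2)
    {a : ZMod p} {α : L} (hα : α ≠ 0) (ha : algebraMap (ZMod p) L a = α + α⁻¹) {m : ℕ}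
    (hm : ¬ 2 ∣ m) (ho : orderOf α = 2 ^ 1 * m) (hm2 : 2 < m) (hmD : m ∣ D₂)
    {n : ℕ} (hn : 0 < n) {c : ℕ} (hc : 2 ^ n = 2 ^ max 1 (n + 1 - v) * c) :
    factType (Chebyshev.C (ZMod p) ((2 ^ n : ℕ) : ℤ) - C a) =
      Multiset.replicate c (2 ^ max 1 (n + 1 - v), 1) := by
  classical
  refine factType_of_dvd_orderOf Nat.prime_two hp2 hα ha (ho ▸ (dvd_mul_right _ _)) n
    ⟨pow_pos two_pos _, one_pos⟩ ?_ ?_ (by rw [mul_one]; exact hc)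
  · intro b hb hob
    rw [ho, ← mul_assoc, ← pow_add] at hob
    have h4 := Nat.pow_le_pow_right (n := 2) two_pos (by omega : 2 ≤ n + 1)
    rw [natDegree_minpoly_of_dvd_D₂ S Nat.prime_two (by omega) hm hm2 hmD hb hob, if_pos rfl]
  · intro b hb _
    refine card_fiber_eq_one (pow_pos two_pos n) hα (fun h => ?_) hb
    have := Nat.le_of_dvd two_pos (orderOf_dvd_of_pow_eq_one h)
    omega

/-- Periodic `a`: one rational root, from the `ℓ ^ n`-th root of `α` with the order of `α`, and for
each `1 ≤ k ≤ n` a class of `(ℓ - 1) * ℓ ^ (k - 1)` roots of degree `E * ℓ ^ (k - v)`. -/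
theorem factType_of_periodic (hℓ : ℓ.Prime) (hpℓ : p ≠ ℓ) (hv : 0 < v)
    {a : ZMod p} {α : L} (hα : α ≠ 0) (ha : algebraMap (ZMod p) L a = α + α⁻¹)
    (hm : ¬ ℓ ∣ orderOf α) (n : ℕ) {A E M : ℕ} (hE : 0 < E) (hA : ℓ - 1 = E * M * A)
    (hM : α ^ 2 ≠ 1 ∧ M = 1 ∨ α ^ 2 = 1 ∧ M = 2 ∧ ℓ ≠ 2)
    (hdeg : ∀ k, 0 < k → ∀ b : L, b ≠ 0 → orderOf b = ℓ ^ k * orderOf α →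
      (minpoly (ZMod p) (b + b⁻¹)).natDegree = E * ℓ ^ (k - v)) :
    factType (Chebyshev.C (ZMod p) ((ℓ ^ n : ℕ) : ℤ) - C a) =
      {(1, 1)} + Multiset.replicate (∑ k ∈ Finset.range (min n v), A * ℓ ^ k) (E, M) +
        ∑ k ∈ Finset.Icc 1 (n - v), Multiset.replicate (A * ℓ ^ (v - 1)) (E * ℓ ^ k, M) := by
  classical
  have hN : 0 < ℓ ^ n := pow_pos hℓ.pos n
  have hM0 : 0 < M := by omega
  rw [factType_of_not_dvd_orderOf hℓ hpℓ hα ha hm n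
    (fun k => if k = 0 then 1 else E * ℓ ^ (k - v)) (fun k => if k = 0 then 1 else M)
    (fun k => if k = 0 then 1 else A * ℓ ^ (min k v - 1)), Finset.sum_range_succ',
    sum_range_eq_add_sum_Icc _ n v, add_comm, add_assoc]
  · congr 1
    congr 1
    · rw [← sum_replicate]
      refine Finset.sum_congr rfl fun k hk => ?_
      rw [Finset.mem_range, lt_min_iff] at hk
      rw [if_neg (by omega), if_neg (by omega), if_neg (by omega), min_eq_left (by omega),
        show k + 1 - v = 0 by omega, pow_zero, mul_one, Nat.add_sub_cancel]
    · refine Finset.sum_congr rfl fun k hk => ?_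
      rw [Finset.mem_Icc] at hk
      rw [if_neg (by omega), if_neg (by omega), if_neg (by omega), min_eq_right (by omega),
        show v + k - 1 + 1 - v = k by omega]
  · intro k _
    split_ifs
    · exact ⟨one_pos, one_pos⟩
    · exact ⟨Nat.mul_pos hE (pow_pos hℓ.pos _), hM0⟩
  · intro k _ b hb ho
    split_ifs with hk
    · rw [hk, pow_zero, one_mul] at ho
      rw [natDegree_minpoly_add_inv_eq_one_iff hb, ho]
      exact orderOf_algebraMap_dvd hα ha
    · exact hdeg k (Nat.pos_of_ne_zero hk) b hb ho
  · intro k _ b hb ho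
    rcases hM with ⟨h2, rfl⟩ | ⟨h2, rfl, hℓ2⟩
    · rw [card_fiber_eq_one hN hα h2 hb, ite_self]
    · rw [card_fiber_eq_ite hN hα h2 hb]
      refine if_congr ?_ rfl rfl
      rw [← orderOf_dvd_iff_pow_eq_one] at h2 ⊢
      constructor
      · intro h
        by_contra hk
        refine hℓ2 ((Nat.prime_dvd_prime_iff_eq hℓ Nat.prime_two).1 (Dvd.dvd.trans ?_ h))
        rw [ho]
        exact (dvd_pow_self ℓ hk).mul_right _
      · rintro rfl
        rw [ho, pow_zero, one_mul]
        exact h2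
  · intro k _
    split_ifs with hk
    · simp [hk]
    · rw [Nat.totient_prime_pow hℓ (Nat.pos_of_ne_zero hk), hA,
        show k - 1 = (k - v) + (min k v - 1) by omega, pow_add]
      ring

/-- For `ℓ = 2` and a cycle attached to `D₂`, the classes `k = 0` and `k = 1` both give a rational
root, since roots of order `2 * orderOf α` still have order dividing `p - 1` or `p + 1`. -/
theorem factType_of_periodic_D₂ (S : SignData 2 p μ v D₁ D₂ σ) (hp2 : p ≠ 2)
    {a : ZMod p} {α : L} (hα : α ≠ 0) (ha : algebraMap (ZMod p) L a = α + α⁻¹)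
    (hm : ¬ 2 ∣ orderOf α) (hm2 : 2 < orderOf α) (hmD : orderOf α ∣ D₂) {n : ℕ} (hn : 0 < n) :
    factType (Chebyshev.C (ZMod p) ((2 ^ n : ℕ) : ℤ) - C a) =
      {(1, 1), (1, 1)} +
        Multiset.replicate (∑ k ∈ Finset.range (min n v - 1), 2 ^ k) (2, 1) +
        ∑ k ∈ Finset.Icc 1 (n - v), Multiset.replicate (2 ^ (v - 1)) (2 ^ k, 1) := by
  classical
  have hv : 2 ≤ v := S.two_le_v
  have hα2 : α ^ 2 ≠ 1 := fun h => by
    have := Nat.le_of_dvd two_pos (orderOf_dvd_of_pow_eq_one h)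
    omega
  obtain ⟨n, rfl⟩ := Nat.exists_eq_add_of_le' hn
  rw [factType_of_not_dvd_orderOf Nat.prime_two hp2 hα ha hm (n + 1)
    (fun k => if k ≤ 1 then 1 else 2 ^ max 1 (k - v)) (fun _ => 1)
    (fun k => if k ≤ 1 then 1 else if k ≤ v then 2 ^ (k - 2) else 2 ^ (v - 1)),
    Finset.sum_range_succ', Finset.sum_range_succ', sum_range_eq_add_sum_Icc _ n (v - 1),
    show min n (v - 1) = min (n + 1) v - 1 by omega,
    show n - (v - 1) = n + 1 - v by omega, add_assoc, add_comm,
    add_assoc ({(1, 1), (1, 1)} : Multiset (ℕ × ℕ))]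
  · congr 1
    congr 1
    · rw [← sum_replicate]
      refine Finset.sum_congr rfl fun k hk => ?_
      rw [Finset.mem_range] at hk
      rw [if_neg (by omega : ¬ k + 1 + 1 ≤ 1), if_neg (by omega : ¬ k + 1 + 1 ≤ 1),
        if_pos (by omega : k + 1 + 1 ≤ v),
        show max 1 (k + 1 + 1 - v) = 1 by omega, show k + 1 + 1 - 2 = k by omega, pow_one]
    · refine Finset.sum_congr rfl fun k hk => ?_
      rw [Finset.mem_Icc] at hk
      rw [if_neg (by omega), if_neg (by omega), if_neg (by omega),
        show v - 1 + k - 1 + 1 + 1 - v = k by omega, max_eq_right hk.1]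
  · intro k _
    refine ⟨?_, one_pos⟩
    split_ifs
    · exact one_pos
    · exact pow_pos two_pos _
  · intro k _ b hb ho
    split_ifs with hk
    · rw [natDegree_minpoly_add_inv_eq_one_iff hb, ho]
      rcases Nat.le_one_iff_eq_zero_or_eq_one.1 hk with rfl | rfl
      · rw [pow_zero, one_mul]
        exact orderOf_algebraMap_dvd hα ha
      · have hp := (Fact.out : p.Prime).eq_two_or_odd.resolve_left hp2
        have hcop : Nat.Coprime (2 ^ 1) (orderOf α) :=
          Nat.Coprime.pow_left 1 ((Nat.prime_two.coprime_iff_not_dvd).2 hm)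
        have h2 : ∀ s : ℤ, (s = 1 ∨ s = -1) → ((2 : ℕ) : ℤ) ^ 1 ∣ (p : ℤ) - s := by
          intro s hs
          rw [pow_one]
          push_cast
          omega
        rw [SignData.cast_mul_dvd_iff hcop, SignData.cast_mul_dvd_iff hcop,
          and_iff_right (h2 1 (Or.inl rfl)), and_iff_right (h2 (-1) (Or.inr rfl))]
        exact orderOf_algebraMap_dvd hα ha
    · have h4 := Nat.pow_le_pow_right (n := 2) two_pos (by omega : 2 ≤ k)
      rw [natDegree_minpoly_of_dvd_D₂ S Nat.prime_two (by omega) hm hm2 hmD hb ho, if_pos rfl]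
  · intro k _ b hb _
    exact card_fiber_eq_one (pow_pos two_pos _) hα hα2 hb
  · intro k _
    split_ifs with hk hkv
    · rcases Nat.le_one_iff_eq_zero_or_eq_one.1 hk with rfl | rfl <;> simp
    · rw [Nat.totient_prime_pow Nat.prime_two (by omega), show 2 - 1 = 1 from rfl, mul_one, mul_one,
        max_eq_left (by omega), ← pow_add]
      congr 1
      omega
    · rw [Nat.totient_prime_pow Nat.prime_two (by omega), show 2 - 1 = 1 from rfl, mul_one, mul_one,
        max_eq_right (by omega), ← pow_add]
      congr 1
      omega

theorem factType_two (S : SignData 2 p μ v D₁ D₂ σ) (hp2 : p ≠ 2) {n : ℕ} (hn : 0 < n) :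
    factType (Chebyshev.C (ZMod p) ((2 ^ n : ℕ) : ℤ) - C 2) =
      {(1, 1), (1, 1)} + ∑ j ∈ Finset.Icc 1 (n - 1),
        Multiset.replicate (2 ^ (min (j + 1) v - 2)) (2 ^ (j + 1 - v), 2) := by
  classical
  let L := AlgebraicClosure (ZMod p)
  have hv : 2 ≤ v := S.two_le_v
  have ha : algebraMap (ZMod p) L 2 = 1 + 1⁻¹ := by
    rw [map_ofNat]
    norm_num
  obtain ⟨n, rfl⟩ := Nat.exists_eq_add_of_le' hn
  have hdeg : ∀ k, 0 < k → ∀ b : L, b ≠ 0 → orderOf b = 2 ^ k * orderOf (1 : L) →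
      (minpoly (ZMod p) (b + b⁻¹)).natDegree = 2 ^ (k - v) := fun k hk b hb ho => by
    rw [orderOf_one] at ho
    rw [natDegree_minpoly_of_dvd_D₁ S Nat.prime_two hp2 hk (by norm_num) (one_dvd _) hb ho,
      S.μ_eq_one rfl, one_mul]
  rw [factType_of_not_dvd_orderOf Nat.prime_two hp2 one_ne_zero ha (by simp) (n + 1)
    (fun k => 2 ^ (k - v)) (fun k => if k ≤ 1 then 1 else 2)
    (fun k => if k ≤ 1 then 1 else 2 ^ (min k v - 2)),
    Finset.sum_range_succ', Finset.sum_range_succ', add_assoc, add_comm, Nat.add_sub_cancel]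
  · congr 1
    · rw [if_pos (by omega), if_pos (by omega), if_pos (by omega), if_pos (by omega),
        Nat.sub_eq_zero_of_le (by omega), Nat.sub_eq_zero_of_le (by omega)]
      rfl
    · have := sum_range_eq_add_sum_Icc
        (fun j => Multiset.replicate (2 ^ (min (j + 2) v - 2)) (2 ^ (j + 2 - v), 2)) n 0
      simp only [Nat.min_zero, Finset.range_zero, Finset.sum_empty, zero_add, Nat.sub_zero] at this
      refine Eq.trans (Finset.sum_congr rfl fun k _ => ?_) (this.trans
        (Finset.sum_congr rfl fun k hk => ?_))
      · rw [if_neg (by omega), if_neg (by omega)]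
      · rw [Finset.mem_Icc] at hk
        rw [show k - 1 + 2 = k + 1 by omega]
  · intro k _
    refine ⟨pow_pos two_pos _, ?_⟩
    split_ifs <;> norm_num
  · intro k _ b hb ho
    rcases Nat.eq_zero_or_pos k with rfl | hk
    · rw [pow_zero, one_mul] at ho
      rw [Nat.zero_sub, pow_zero, natDegree_minpoly_add_inv_eq_one_iff hb, ho, orderOf_one]
      exact Or.inl (one_dvd _)
    · exact hdeg k hk b hb ho
  · intro k _ b hb ho
    rw [card_fiber_eq_ite (pow_pos two_pos _) one_ne_zero (one_pow 2) hb]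
    refine if_congr ?_ rfl rfl
    rw [← orderOf_dvd_iff_pow_eq_one, ho, orderOf_one, mul_one]
    exact Nat.pow_dvd_pow_iff_le_right (l := 1) Nat.one_lt_two
  · intro k _
    split_ifs with hk
    · rcases Nat.le_one_iff_eq_zero_or_eq_one.1 hk with rfl | rfl
      · simp
      · rw [Nat.sub_eq_zero_of_le (by omega)]
        simp
    · rw [Nat.totient_prime_pow Nat.prime_two (by omega), show 2 - 1 = 1 from rfl, mul_one,
        mul_assoc, ← pow_succ', ← pow_add]
      congr 1
      omega

end Types

/-! ### Preperiods and the factorization of the iterates -/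

section Preperiods

variable {ℓ p μ v D₁ D₂ : ℕ} {σ : ℤ} [Fact p.Prime]

theorem preperiod_bounds (S : SignData ℓ p μ v D₁ D₂ σ) (hℓ : ℓ.Prime) (a : ZMod p) :
    preperiod (chebMap ℓ p) a ≤ v ∧ (0 < preperiod (chebMap ℓ p) a → μ = 1) := by
  obtain ⟨α, m, hα, ha, -, ho⟩ := exists_add_inv_orderOf_eq (AlgebraicClosure (ZMod p)) hℓ a
  rcases Nat.eq_zero_or_pos (preperiod (chebMap ℓ p) a) with h0 | h0
  · rw [h0]
    exact ⟨Nat.zero_le _, fun h => absurd h (lt_irrefl 0)⟩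
  · rcases lt_or_ge 2 (ℓ ^ preperiod (chebMap ℓ p) a) with h | h
    · have := S.of_pow_mul_dvd hℓ h (ho ▸ orderOf_algebraMap_dvd hα ha)
      exact ⟨this.2.1, fun _ => this.1⟩
    · obtain ⟨h1, h2⟩ := eq_two_of_pow_le_two hℓ h0 h
      rw [h2]
      exact ⟨S.v_pos, fun _ => S.μ_eq_one h1⟩

/-- The bound `v` for preperiods is attained at `ζ + ζ⁻¹` with `ζ` of order `ℓ ^ v`, which lies in
`𝔽_p` because `ℓ ^ v` divides `D₁ = p - σ`. -/
theorem maxPreperiod_eq (S : SignData ℓ p μ v D₁ D₂ σ) (hℓ : ℓ.Prime) (hpℓ : p ≠ ℓ)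
    (h : 0 < maxPreperiod ℓ p) : μ = 1 ∧ maxPreperiod ℓ p = v := by
  obtain ⟨a₀, -, ha₀⟩ := Finset.lt_sup_iff.1 h
  obtain rfl := (preperiod_bounds S hℓ a₀).2 ha₀
  refine ⟨rfl, le_antisymm (Finset.sup_le fun a _ => (preperiod_bounds S hℓ a).1) ?_⟩
  let L := AlgebraicClosure (ZMod p)
  have : NeZero ((ℓ ^ v : ℕ) : L) := ⟨natCast_pow_ne_zero (p := p) hℓ hpℓ v⟩
  obtain ⟨ζ, hζ⟩ := HasEnoughRootsOfUnity.exists_primitiveRoot L (ℓ ^ v)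
  have hζ0 : ζ ≠ 0 := hζ.ne_zero (pow_ne_zero _ hℓ.ne_zero)
  have hdvd : ((ℓ ^ v : ℕ) : ℤ) ∣ (D₁ : ℤ) := Int.natCast_dvd_natCast.2 S.pow_dvd_D₁
  rw [S.D₁_eq, pow_one (p : ℤ), hζ.eq_orderOf] at hdvd
  obtain ⟨a, ha⟩ := (mem_range_iff_orderOf_dvd (p := p) hζ0).2 (by
    rcases S.sign with rfl | rfl
    · exact Or.inl hdvd
    · exact Or.inr hdvd)
  have hpre : preperiod (chebMap ℓ p) a = v :=
    preperiod_chebMap_eq (m := 1) hℓ hζ0 ha (by simpa using hℓ.ne_one)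
      (by rw [mul_one, ← hζ.eq_orderOf])
  exact hpre.symm.trans_le
    (Finset.le_sup (f := fun a : ZMod p => preperiod (chebMap ℓ p) a) (Finset.mem_univ a))

/-- For odd `ℓ` the hypotheses on the cycle and on `-2` are not needed: a preperiod `ρ > 0` already
forces `ℓ ∣ orderOf α`, hence `orderOf α ∣ D₁` and `α ^ 2 ≠ 1`. -/
theorem factType_of_preperiod (S : SignData ℓ p μ v D₁ D₂ σ) (hℓ : ℓ.Prime) (hpℓ : p ≠ ℓ)
    {a : ZMod p} {ρ : ℕ} (hρ : ρ = preperiod (chebMap ℓ p) a) (hρ0 : 0 < ρ)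
    (hD : ℓ = 2 → CycleDivides ℓ p a D₁) (ha2 : ℓ = 2 → a ≠ -2) {n : ℕ} (hn : 0 < n) :
    (n + ρ ≤ v → factType (Chebyshev.C (ZMod p) ((ℓ ^ n : ℕ) : ℤ) - C a) =
      Multiset.replicate (ℓ ^ n) (1, 1)) ∧
    (v < n + ρ → factType (Chebyshev.C (ZMod p) ((ℓ ^ n : ℕ) : ℤ) - C a) =
      Multiset.replicate (ℓ ^ (v - ρ)) (ℓ ^ (n + ρ - v), 1)) := by
  obtain ⟨α, m, hα, ha, hm, ho⟩ := exists_add_inv_orderOf_eq (AlgebraicClosure (ZMod p)) hℓ a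
  obtain ⟨hle, hμ⟩ := preperiod_bounds S hℓ a
  rw [← hρ] at ho hle hμ
  have hmD : m ∣ D₁ := by
    rcases eq_or_ne ℓ 2 with rfl | h2
    · exact (hD rfl).dvd hℓ hα ha (hρ ▸ ho)
    · have h3 : 2 < ℓ ^ ρ := by
        by_contra hlt
        exact h2 (eq_two_of_pow_le_two hℓ hρ0 (not_lt.1 hlt)).1
      exact (dvd_mul_left _ _).trans
        (S.of_pow_mul_dvd hℓ h3 (ho ▸ orderOf_algebraMap_dvd hα ha)).2.2
  have hα2 : α ^ 2 ≠ 1 := by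
    intro h
    have h1 : ℓ ∣ 2 := Dvd.dvd.trans (ho ▸ (dvd_pow_self ℓ hρ0.ne').mul_right m)
      (orderOf_dvd_of_pow_eq_one h)
    have h2 := (Nat.prime_dvd_prime_iff_eq hℓ Nat.prime_two).1 h1
    rcases sq_eq_one_iff.1 h with rfl | h
    · rw [orderOf_one] at ho
      have h3 : ℓ ∣ 1 := ho ▸ (dvd_pow_self ℓ hρ0.ne').mul_right m
      exact hℓ.ne_one (Nat.dvd_one.1 h3)
    · exact ha2 h2 ((eq_neg_one_iff_of_algebraMap_eq hα ha).1 h)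
  have key := fun c => factType_of_strict_D₁ S hℓ hpℓ hα ha hρ0 hm ho (hμ hρ0) hmD hn (c := c)
    (Or.inl ⟨hα2, rfl⟩)
  constructor
  · intro h
    have h0 : n + ρ - v = 0 := by omega
    rw [key (ℓ ^ n) (by rw [h0]; ring), h0, pow_zero]
  · intro h
    refine key _ ?_
    rw [mul_one, ← pow_add]
    congr 1
    omega

theorem irreducible_chebyshevC_sub_C {a : ZMod p} (hℓ : ℓ.Prime) (hpℓ : p ≠ ℓ) {n d : ℕ}
    (h : factType (Chebyshev.C (ZMod p) ((ℓ ^ n : ℕ) : ℤ) - C a) = {(d, 1)}) :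
    Irreducible (Chebyshev.C (ZMod p) ((ℓ ^ n : ℕ) : ℤ) - C a) := by
  obtain ⟨α, hα, ha⟩ := exists_add_inv_eq (algebraMap (ZMod p) (AlgebraicClosure (ZMod p)) a)
  exact irreducible_of_factType_eq (monic_chebyshevC_sub_C
    (natCast_pow_ne_zero (p := p) hℓ hpℓ n) hα ha.symm).ne_zero h

theorem splits_chebyshevC_sub_C {a : ZMod p} (hℓ : ℓ.Prime) (hpℓ : p ≠ ℓ) {n c : ℕ}
    (h : factType (Chebyshev.C (ZMod p) ((ℓ ^ n : ℕ) : ℤ) - C a) = Multiset.replicate c (1, 1)) :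
    (Chebyshev.C (ZMod p) ((ℓ ^ n : ℕ) : ℤ) - C a).Splits := by
  obtain ⟨α, hα, ha⟩ := exists_add_inv_eq (algebraMap (ZMod p) (AlgebraicClosure (ZMod p)) a)
  refine splits_of_factType_degree_one (monic_chebyshevC_sub_C
    (natCast_pow_ne_zero (p := p) hℓ hpℓ n) hα ha.symm).ne_zero fun x hx => ?_
  rw [h] at hx
  rw [Multiset.eq_of_mem_replicate hx]

theorem cycleDivides_D₁_of_two_lt (S : SignData ℓ p μ v D₁ D₂ σ) (hℓ : ℓ.Prime) {a : ZMod p}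
    (h : 2 < ℓ ^ preperiod (chebMap ℓ p) a) : CycleDivides ℓ p a D₁ := by
  obtain ⟨α, m, hα, ha, -, ho⟩ := exists_add_inv_orderOf_eq (AlgebraicClosure (ZMod p)) hℓ a
  refine ⟨Units.mk0 _ (pow_ne_zero (ℓ ^ preperiod (chebMap ℓ p) a) hα), ?_, ?_⟩
  · rw [algebraMap_iterate_chebMap hα ha, Units.val_inv_eq_inv_val, Units.val_mk0]
  · rw [← orderOf_units, Units.val_mk0,
      orderOf_pow_of_dvd (pow_ne_zero _ hℓ.ne_zero) (ho ▸ dvd_mul_right _ _), ho,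
      Nat.mul_div_cancel_left _ (pow_pos hℓ.pos _)]
    exact (dvd_mul_left _ _).trans
      (S.of_pow_mul_dvd hℓ h (ho ▸ orderOf_algebraMap_dvd hα ha)).2.2

theorem preperiod_neg_two (hp2 : p ≠ 2) : preperiod (chebMap 2 p) (-2 : ZMod p) = 1 := by
  let L := AlgebraicClosure (ZMod p)
  have hL : CharP L p := charP_of_injective_algebraMap (algebraMap (ZMod p) L).injective p
  refine preperiod_chebMap_eq (L := L) (α := -1) (m := 1) Nat.prime_two (by norm_num) ?_
    (by norm_num) ?_
  · rw [map_neg, map_ofNat]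
    norm_num
  · rw [orderOf_neg_one, ringChar.eq L p, if_neg hp2]
    rfl

theorem factType_neg_two (S : SignData 2 p μ v D₁ D₂ σ) (hp2 : p ≠ 2) {n : ℕ} (hn : 0 < n) :
    factType (Chebyshev.C (ZMod p) ((2 ^ n : ℕ) : ℤ) - C (-2)) =
      Multiset.replicate (2 ^ (min (n + 1) v - 2)) (2 ^ (n + 1 - v), 2) := by
  let L := AlgebraicClosure (ZMod p)
  have hL : CharP L p := charP_of_injective_algebraMap (algebraMap (ZMod p) L).injective p
  have hv : 2 ≤ v := S.two_le_v
  refine factType_of_strict_D₁ (L := L) (α := -1) (m := 1) S Nat.prime_two hp2 (by norm_num) ?_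
    one_pos (by norm_num) ?_ (S.μ_eq_one rfl) (one_dvd _) hn (Or.inr ⟨by norm_num, rfl⟩) ?_
  · rw [map_neg, map_ofNat]
    norm_num
  · rw [orderOf_neg_one, ringChar.eq L p, if_neg hp2]
    rfl
  · rw [← pow_succ, ← pow_add]
    congr 1
    omega

end Preperiods

theorem chebyshevC_two_pow_succ_sub_two (R : Type*) [CommRing R] (n : ℕ) :
    Chebyshev.C R ((2 ^ (n + 1) : ℕ) : ℤ) - 2 =
      (Chebyshev.C R ((2 ^ n : ℕ) : ℤ) - 2) * (Chebyshev.C R ((2 ^ n : ℕ) : ℤ) + 2) := by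
  have : ((2 ^ (n + 1) : ℕ) : ℤ) = 2 * ((2 ^ n : ℕ) : ℤ) := by push_cast; ring
  rw [this, Chebyshev.C_mul, Chebyshev.C_two]
  simp only [sub_comp, pow_comp, X_comp, ofNat_comp]
  ring

theorem chebyshevC_two_pow_sub_two (R : Type*) [CommRing R] (n : ℕ) :
    Chebyshev.C R ((2 ^ (n + 1) : ℕ) : ℤ) - 2 =
      (X - 2) * (X + 2) * ∏ j ∈ Finset.Icc 1 n, (chebIter R 2 j + 2) := by
  induction n with
  | zero =>
    rw [chebyshevC_two_pow_succ_sub_two]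
    simp
  | succ n ih =>
    rw [chebyshevC_two_pow_succ_sub_two, ih, Finset.prod_Icc_succ_top (by omega),
      chebIter_eq R 2 (n + 1)]
    ring

theorem theorem3p1 (ℓ p : ℕ) (hℓ : ℓ.Prime) [hp : Fact p.Prime] (hpℓ : p ≠ ℓ) (t : ℤ)
    (hirr : ∀ n : ℕ, 1 ≤ n → Irreducible (chebIter ℤ ℓ n - Polynomial.C t))
    (μ D₁ D₂ v ρ : ℕ)
    (hμ : μ = chebMu ℓ p ((Nat.coprime_primes hp.out hℓ).2 hpℓ))
    (hD₁ : D₁ = chebD₁ ℓ p μ) (hD₂ : D₂ = chebD₂ ℓ p μ)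
    (hv : v = padicValNat ℓ D₁)
    (hρ : ρ = preperiod (chebMap ℓ p) (t : ZMod p))
    (n : ℕ) (hn : 1 ≤ n) :
    -- `ℓ` odd
    (ℓ ≠ 2 →
      -- `t̄` strictly preperiodic
      (0 < ρ →
        (n + ρ ≤ v → factType (chebRed ℓ p n t) = Multiset.replicate (ℓ ^ n) (1, 1)) ∧
        (v < n + ρ → factType (chebRed ℓ p n t) =
          Multiset.replicate (ℓ ^ (v - ρ)) (ℓ ^ (n + ρ - v), 1)) ∧
        (ρ = v → Irreducible (chebRed ℓ p n t))) ∧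
      -- `t̄ = ±2`
      ((t : ZMod p) = 2 ∨ (t : ZMod p) = -2 →
        factType (chebRed ℓ p n t) =
          {(1, 1)} +
          Multiset.replicate (∑ k ∈ Finset.range (min n v), (ℓ - 1) / (2 * μ) * ℓ ^ k) (μ, 2) +
          ∑ k ∈ Finset.Icc 1 (n - v),
            Multiset.replicate ((ℓ - 1) / (2 * μ) * ℓ ^ (v - 1)) (μ * ℓ ^ k, 2)) ∧
      -- `t̄ ≠ ±2` periodic, cycle attached to `D₁`
      ((t : ZMod p) ≠ 2 → (t : ZMod p) ≠ -2 → ρ = 0 → CycleDivides ℓ p (t : ZMod p) D₁ →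
        factType (chebRed ℓ p n t) =
          {(1, 1)} +
          Multiset.replicate (∑ k ∈ Finset.range (min n v), (ℓ - 1) / μ * ℓ ^ k) (μ, 1) +
          ∑ k ∈ Finset.Icc 1 (n - v),
            Multiset.replicate ((ℓ - 1) / μ * ℓ ^ (v - 1)) (μ * ℓ ^ k, 1)) ∧
      -- `t̄ ≠ ±2` periodic, cycle attached to `D₂`
      ((t : ZMod p) ≠ 2 → (t : ZMod p) ≠ -2 → ρ = 0 → CycleDivides ℓ p (t : ZMod p) D₂ →
        factType (chebRed ℓ p n t) =
          {(1, 1)} +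
          Multiset.replicate (∑ k ∈ Finset.range (min n v), (ℓ - 1) / (2 * μ) * ℓ ^ k)
            (2 * μ, 1) +
          ∑ k ∈ Finset.Icc 1 (n - v),
            Multiset.replicate ((ℓ - 1) / (2 * μ) * ℓ ^ (v - 1)) (2 * μ * ℓ ^ k, 1))) ∧
    -- `ℓ = 2`
    (ℓ = 2 →
      -- `t̄ ≠ -2` strictly preperiodic, its cycle attached to `D₁`
      (0 < ρ → (t : ZMod p) ≠ -2 → CycleDivides ℓ p (t : ZMod p) D₁ →
        (n + ρ ≤ v → factType (chebRed ℓ p n t) = Multiset.replicate (2 ^ n) (1, 1)) ∧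
        (v < n + ρ → factType (chebRed ℓ p n t) =
          Multiset.replicate (2 ^ (v - ρ)) (2 ^ (n + ρ - v), 1)) ∧
        (ρ = v → Irreducible (chebRed ℓ p n t))) ∧
      -- `t̄` strictly preperiodic, its cycle attached to `D₂` and not the fixed point `2`
      -- (whose tree is attached to `D₁`)
      (0 < ρ → (chebMap ℓ p)^[ρ] (t : ZMod p) ≠ 2 → CycleDivides ℓ p (t : ZMod p) D₂ →
        (n + ρ ≤ v → factType (chebRed ℓ p n t) = Multiset.replicate (2 ^ (n - 1)) (2, 1)) ∧
        (v < n + ρ → factType (chebRed ℓ p n t) =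
          Multiset.replicate (2 ^ (v - ρ)) (2 ^ (n + ρ - v), 1))) ∧
      -- `t̄ = -2`
      ((t : ZMod p) = -2 →
        (n + ρ ≤ v → factType (chebRed ℓ p n t) = Multiset.replicate (2 ^ (n - 1)) (1, 2)) ∧
        (v < n + ρ → factType (chebRed ℓ p n t) =
          Multiset.replicate (2 ^ (v - ρ - 1)) (2 ^ (n + ρ - v), 2))) ∧
      -- `t̄ = 2`
      ((t : ZMod p) = 2 →
        chebRed ℓ p n t =
          (Polynomial.X - 2) * (Polynomial.X + 2) *
            ∏ j ∈ Finset.Icc 1 (n - 1), (chebIter (ZMod p) 2 j + 2) ∧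
        (∀ j : ℕ, 1 ≤ j →
          (j + 1 ≤ v → factType (chebIter (ZMod p) 2 j + 2) =
            Multiset.replicate (2 ^ (j - 1)) (1, 2)) ∧
          (v < j + 1 → factType (chebIter (ZMod p) 2 j + 2) =
            Multiset.replicate (2 ^ (v - 2)) (2 ^ (j + 1 - v), 2))) ∧
        factType (chebRed ℓ p n t) =
          {(1, 1), (1, 1)} +
          ∑ j ∈ Finset.Icc 1 (n - 1), factType (chebIter (ZMod p) 2 j + 2)) ∧
      -- `t̄ ≠ 2` periodic, cycle attached to `D₁`
      ((t : ZMod p) ≠ 2 → ρ = 0 → CycleDivides ℓ p (t : ZMod p) D₁ →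
        factType (chebRed ℓ p n t) =
          {(1, 1)} +
          Multiset.replicate (∑ k ∈ Finset.range (min n v), 2 ^ k) (1, 1) +
          ∑ k ∈ Finset.Icc 1 (n - v), Multiset.replicate (2 ^ (v - 1)) (2 ^ k, 1)) ∧
      -- `t̄ ≠ 2` periodic, cycle attached to `D₂`
      ((t : ZMod p) ≠ 2 → ρ = 0 → CycleDivides ℓ p (t : ZMod p) D₂ →
        factType (chebRed ℓ p n t) =
          {(1, 1), (1, 1)} +
          Multiset.replicate (∑ k ∈ Finset.range (min n v - 1), 2 ^ k) (2, 1) +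
          ∑ k ∈ Finset.Icc 1 (n - v), Multiset.replicate (2 ^ (v - 1)) (2 ^ k, 1))) ∧
    -- In particular, in terms of the largest preperiod on `𝔽_p`:
    (0 < maxPreperiod ℓ p → ρ = maxPreperiod ℓ p → Irreducible (chebRed ℓ p n t)) ∧
    (ℓ ≠ 2 → 0 < ρ → n + ρ ≤ maxPreperiod ℓ p → (chebRed ℓ p n t).Splits) := by
  classical
  obtain ⟨σ, S⟩ := exists_signData hℓ hp.out hpℓ
  rw [← hμ, ← hD₁, ← hD₂, ← hv] at S
  set a : ZMod p := (t : ZMod p) with ha_def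
  obtain ⟨α, m, hα, ha, hm, ho⟩ := exists_add_inv_orderOf_eq (AlgebraicClosure (ZMod p)) hℓ a
  have hn0 : 0 < n := hn
  rw [chebRed_eq, ← ha_def]
  -- Preperiod `v` gives a single factor; for `ℓ = 2` it excludes `a = -2`, of preperiod `1 < v`.
  have hirred : ρ = v → 2 < ℓ ^ ρ →
      Irreducible (Chebyshev.C (ZMod p) ((ℓ ^ n : ℕ) : ℤ) - C a) := by
    intro h h2
    have h3 := (factType_of_preperiod S hℓ hpℓ hρ (h ▸ S.v_pos)
      (fun _ => cycleDivides_D₁_of_two_lt S hℓ (hρ ▸ h2)) (fun hl ha2 => by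
        subst hl
        rw [hρ, ha2, preperiod_neg_two hpℓ] at h2
        omega) hn0).2 (by omega)
    rw [h, Nat.sub_self, pow_zero, Multiset.replicate_one] at h3
    exact irreducible_chebyshevC_sub_C hℓ hpℓ h3
  have hvpow : ρ = v → 2 < ℓ ^ ρ := fun h => h ▸ S.two_lt
  refine ⟨fun hℓ2 => ⟨?_, ?_, ?_, ?_⟩, fun hℓ2 => ?_, ?_, ?_⟩
  · intro hρ0
    have h := factType_of_preperiod S hℓ hpℓ hρ hρ0 (fun h => absurd h hℓ2)
      (fun h => absurd h hℓ2) hn0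
    exact ⟨h.1, h.2, fun h => hirred h (hvpow h)⟩
  · intro h2
    have hα2 := (sq_eq_one_iff_of_algebraMap_eq hα ha).2 h2
    have hod : orderOf α ∣ 2 := orderOf_dvd_of_pow_eq_one hα2
    have hℓo : ¬ ℓ ∣ orderOf α := fun h =>
      hℓ2 ((Nat.prime_dvd_prime_iff_eq hℓ Nat.prime_two).1 (h.trans hod))
    have hoD : orderOf α ∣ D₁ := orderOf_dvd_D₁_of_sq_eq_one S hα2
    have hA : ℓ - 1 = μ * 2 * ((ℓ - 1) / (2 * μ)) := by
      rw [mul_comm μ 2, Nat.mul_div_cancel' (S.two_mul_μ_dvd hℓ2)]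
    exact factType_of_periodic hℓ hpℓ S.v_pos hα ha hℓo n S.μ_pos hA
      (Or.inr ⟨hα2, rfl, hℓ2⟩) fun k hk b hb hob =>
        natDegree_minpoly_of_dvd_D₁ S hℓ hpℓ hk hℓo hoD hb hob
  · intro h2 h2' hρ0 hcyc
    have hmD := hcyc.dvd hℓ hα ha ho
    rw [← hρ, hρ0, pow_zero, one_mul] at ho
    rw [← ho] at hm hmD
    have hα2 : α ^ 2 ≠ 1 := fun h =>
      ((sq_eq_one_iff_of_algebraMap_eq hα ha).1 h).elim h2 h2'
    have hA : ℓ - 1 = μ * 1 * ((ℓ - 1) / μ) := by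
      rw [mul_one, Nat.mul_div_cancel' ((dvd_mul_left _ _).trans (S.two_mul_μ_dvd hℓ2))]
    exact factType_of_periodic hℓ hpℓ S.v_pos hα ha hm n S.μ_pos hA
      (Or.inl ⟨hα2, rfl⟩) fun k hk b hb hob =>
        natDegree_minpoly_of_dvd_D₁ S hℓ hpℓ hk hm hmD hb hob
  · intro h2 h2' hρ0 hcyc
    have hmD := hcyc.dvd hℓ hα ha ho
    rw [← hρ, hρ0, pow_zero, one_mul] at ho
    rw [← ho] at hm hmD
    have hα2 : α ^ 2 ≠ 1 := fun h =>
      ((sq_eq_one_iff_of_algebraMap_eq hα ha).1 h).elim h2 h2'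
    have hm2 := two_lt_orderOf (orderOf_pos_of_algebraMap_eq hα ha) hα2
    have hA : ℓ - 1 = 2 * μ * 1 * ((ℓ - 1) / (2 * μ)) := by
      rw [mul_one, Nat.mul_div_cancel' (S.two_mul_μ_dvd hℓ2)]
    refine factType_of_periodic hℓ hpℓ S.v_pos hα ha hm n (Nat.mul_pos two_pos S.μ_pos) hA
      (Or.inl ⟨hα2, rfl⟩) fun k hk b hb hob => ?_
    have h3 : 2 < ℓ ^ k := by
      by_contra hlt
      exact hℓ2 (eq_two_of_pow_le_two hℓ hk (not_lt.1 hlt)).1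
    rw [natDegree_minpoly_of_dvd_D₂ S hℓ h3 hm hm2 hmD hb hob, if_neg hℓ2]
  · subst hℓ2
    have hv2 := S.two_le_v
    refine ⟨?_, ?_, ?_, ?_, ?_, ?_⟩
    · intro hρ0 ha2 hcyc
      have h := factType_of_preperiod S hℓ hpℓ hρ hρ0 (fun _ => hcyc) (fun _ => ha2) hn0
      exact ⟨h.1, h.2, fun h => hirred h (hvpow h)⟩
    · intro hρ0 hc2 hcyc
      have hmD := hcyc.dvd hℓ hα ha ho
      rw [← hρ] at ho
      -- For `m = 1` the orbit would end at the fixed point `2`.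
      have hm1 : m ≠ 1 := by
        rintro rfl
        apply hc2
        rw [← (algebraMap (ZMod p) (AlgebraicClosure (ZMod p))).injective.eq_iff,
          algebraMap_iterate_chebMap hα ha, orderOf_dvd_iff_pow_eq_one.1 (by rw [ho, mul_one]),
          map_ofNat]
        norm_num
      have hm2 : 2 < m := by
        have : m ≠ 0 := by rintro rfl; simp at hm
        omega
      -- A preperiod `ρ ≥ 2` would make `m` divide both `D₁` and `D₂`, hence `m ≤ 2`.
      have hρ1 : ρ = 1 := by
        by_contra hne
        have h4 := Nat.pow_le_pow_right (n := 2) two_pos (by omega : 2 ≤ ρ)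
        have h5 := (S.of_pow_mul_dvd hℓ (r := ρ) (m := m) (by omega)
          (ho ▸ orderOf_algebraMap_dvd hα ha)).2.2
        have := S.le_two_of_dvd ((dvd_mul_left _ _).trans h5) hmD
        omega
      rw [hρ1] at ho ⊢
      have key := fun c => factType_of_strict_D₂ S hpℓ hα ha hm ho hm2 hmD hn0 (c := c)
      constructor
      · intro h
        have h1 : max 1 (n + 1 - v) = 1 := by omega
        rw [key (2 ^ (n - 1)) (by rw [h1, ← pow_add]; congr 1; omega), h1, pow_one]
      · intro h
        have h1 : max 1 (n + 1 - v) = n + 1 - v := by omega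
        rw [key (2 ^ (v - 1)) (by rw [h1, ← pow_add]; congr 1; omega), h1]
    · intro ha2
      have hρ1 : ρ = 1 := by rw [hρ, ha2, preperiod_neg_two hpℓ]
      rw [hρ1, ha2, factType_neg_two S hpℓ hn0]
      constructor
      · intro h
        rw [min_eq_left h, show n + 1 - v = 0 by omega, pow_zero, show n + 1 - 2 = n - 1 by omega]
      · intro h
        rw [min_eq_right h.le, show v - 1 - 1 = v - 2 by omega]
    · intro ha2
      have hj : ∀ j : ℕ, 1 ≤ j → factType (chebIter (ZMod p) 2 j + 2) =
          Multiset.replicate (2 ^ (min (j + 1) v - 2)) (2 ^ (j + 1 - v), 2) := by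
        intro j hj
        rw [← factType_neg_two S hpℓ hj, chebIter_eq, C_neg, sub_neg_eq_add]
        rfl
      refine ⟨?_, fun j hj1 => ⟨fun h => ?_, fun h => ?_⟩, ?_⟩
      · obtain ⟨k, rfl⟩ := Nat.exists_eq_add_of_le' hn
        rw [ha2, Nat.add_sub_cancel, ← chebyshevC_two_pow_sub_two]
        rfl
      · rw [hj j hj1, min_eq_left h, show j + 1 - v = 0 by omega, pow_zero,
          show j + 1 - 2 = j - 1 by omega]
      · rw [hj j hj1, min_eq_right h.le]
      · rw [ha2, factType_two S hpℓ hn0]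
        congr 1
        exact Finset.sum_congr rfl fun j hj' => (hj j (Finset.mem_Icc.1 hj').1).symm
    · intro h2 hρ0 hcyc
      have hmD := hcyc.dvd hℓ hα ha ho
      rw [← hρ, hρ0, pow_zero, one_mul] at ho
      rw [← ho] at hm hmD
      have h2' : a ≠ -2 := fun h => by
        rw [hρ, h, preperiod_neg_two hpℓ] at hρ0
        exact one_ne_zero hρ0
      have hα2 : α ^ 2 ≠ 1 := fun h =>
        ((sq_eq_one_iff_of_algebraMap_eq hα ha).1 h).elim h2 h2'
      have := factType_of_periodic hℓ hpℓ S.v_pos hα ha hm n (A := 1) (E := 1) (M := 1) one_pos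
        rfl (Or.inl ⟨hα2, rfl⟩) fun k hk b hb hob => by
          rw [natDegree_minpoly_of_dvd_D₁ S hℓ hpℓ hk hm hmD hb hob, S.μ_eq_one rfl]
      simpa only [one_mul] using this
    · intro h2 hρ0 hcyc
      have hmD := hcyc.dvd hℓ hα ha ho
      rw [← hρ, hρ0, pow_zero, one_mul] at ho
      rw [← ho] at hm hmD
      have h2' : a ≠ -2 := fun h => by
        rw [hρ, h, preperiod_neg_two hpℓ] at hρ0
        exact one_ne_zero hρ0
      have hα2 : α ^ 2 ≠ 1 := fun h =>
        ((sq_eq_one_iff_of_algebraMap_eq hα ha).1 h).elim h2 h2'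
      have hm2 := two_lt_orderOf (orderOf_pos_of_algebraMap_eq hα ha) hα2
      exact factType_of_periodic_D₂ S hpℓ hα ha hm hm2 hmD hn0
  · intro h0 h
    have hρv := h.trans (maxPreperiod_eq S hℓ hpℓ h0).2
    exact hirred hρv (hvpow hρv)
  · intro hℓ2 hρ0 h
    rw [(maxPreperiod_eq S hℓ hpℓ (by omega)).2] at h
    exact splits_chebyshevC_sub_C hℓ hpℓ ((factType_of_preperiod S hℓ hpℓ hρ hρ0
      (fun h => absurd h hℓ2) (fun h => absurd h hℓ2) hn0).1 h)
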